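/- Let $p$ be a prime number. All groups are abelian and additively written. A Polish abelian group $G$ is *pro-Lie* if every neighborhood of $0$ contains a closed subgroup $N$ which is *co-Lie*, i.e. $G/N\cong\mathbb{R}^n\oplus\mathbb{T}^d\oplus D$ for some $n,d\in\mathbb{N}$ and some countable discrete group $D$. A *pro-$p$ Polish abelian group* is a pro-Lie Polish abelian group $G$ such that every co-Lie subgroup of $G$ contains a co-Lie subgroup $N$ for which $G/N$ is a topological $p$-group, i.e. $p^k x\to 0$ for every $x\in G/N$ (equivalently, $p^k x\to 0$ for every $x\in G$). Let $\mathbf{PAb}(p)$ be the category of pro-$p$ Polish abelian groups and continuous homomorphisms. Then: 1. $\mathbf{PAb}(p)$ is quasi-abelian: it is additive, finitely complete and finitely cocomplete, push-outs of kernels are kernels, and pull-backs of cokernels are cokernels. It is regarded as an exact category whose short exact sequences are the kernel-cokernel pairs; an admissible monic is the first map of such a pair, and an object $I$ is injective if every morphism $X\to I$ extends along every admissible monic $X\to Y$. 2. $\mathbf{PAb}(p)$ has enough injectives: every object admits an admissible monic into an injective object. More precisely, let $\mathbb{Z}(p^\infty)$ be the $p$-primary part of $\mathbb{Q}/\mathbb{Z}$,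 and let $\mathbb{Z}(p^\infty)^{(\omega)}$ be the countable direct sum of copies of it, with the discrete topology. Then the countable power $(\mathbb{Z}(p^\infty)^{(\omega)})^{\omega}$, with the product topology, is an injective object of $\mathbf{PAb}(p)$, and every object of $\mathbf{PAb}(p)$ admits an admissible monic into it which is a closed embedding. 3. Quotients of injectives are injective: if $A$ is an injective object of $\mathbf{PAb}(p)$, $B$ is a Polish abelian group, and $\pi:A\to B$ is a surjective continuous homomorphism, then $B$ belongs to $\mathbf{PAb}(p)$ and is injective in it. 4. $\mathbf{PAb}(p)$ has homological dimension $1$: writing $\mathrm{Ext}^n(A,B)=\mathrm{Hom}_{\mathrm{D}(\mathbf{PAb}(p))}(A,B[n])$, where the derived category $\mathrm{D}(\mathbf{PAb}(p))$ is the localization of the homotopy category of complexes at the chain maps with acyclic mapping cone, the least integer $d$ such that $\mathrm{Ext}^n(A,B)=0$ for all objects $A,B$ and all $n>d$ is $d=1$. -/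

import Mathlib

open CategoryTheory CategoryTheory.Limits Topology Filter

/-! ### Exact structure, injectives and homological dimension in additive categories -/

namespace QuasiAb

section General

universe v u

variable {C : Type u} [Category.{v} C] [Preadditive C]

/-- `X ⟶ Y ⟶ Z` is a kernel-cokernel pair: `f` is a kernel of `g` and `g` is a cokernel of `f`.
These are the short exact sequences of the canonical exact structure. -/
def IsKernelCokernelPair {X Y Z : C} (f : X ⟶ Y) (g : Y ⟶ Z) : Prop :=
  ∃ w : f ≫ g = 0,
    Nonempty (IsLimit (KernelFork.ofι f w)) ∧ Nonempty (IsColimit (CokernelCofork.ofπ g w))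

/-- `f` is a kernel of some morphism. -/
def IsKernelMap {X Y : C} (f : X ⟶ Y) : Prop :=
  ∃ (Z : C) (g : Y ⟶ Z) (w : f ≫ g = 0), Nonempty (IsLimit (KernelFork.ofι f w))

/-- `g` is a cokernel of some morphism. -/
def IsCokernelMap {Y Z : C} (g : Y ⟶ Z) : Prop :=
  ∃ (X : C) (f : X ⟶ Y) (w : f ≫ g = 0), Nonempty (IsColimit (CokernelCofork.ofπ g w))

/-- Admissible monic: the first map of a short exact sequence. -/
def AdmissibleMono {X Y : C} (f : X ⟶ Y) : Prop :=
  ∃ (Z : C) (g : Y ⟶ Z), IsKernelCokernelPair f g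

/-- `I` is injective for the exact structure given by the kernel-cokernel pairs. -/
def IsInjective (I : C) : Prop :=
  ∀ ⦃X Y : C⦄ (m : X ⟶ Y), AdmissibleMono m → ∀ f : X ⟶ I, ∃ g : Y ⟶ I, m ≫ g = f

variable (C) in
/-- Every object admits an admissible monic into an injective object. -/
def HasEnoughInjectives : Prop :=
  ∀ A : C, ∃ (I : C) (m : A ⟶ I), IsInjective I ∧ AdmissibleMono m

variable (C) in
/-- A quasi-abelian category: a finitely complete and finitely cocomplete additive category in
which push-outs of kernels are kernels and pull-backs of cokernels are cokernels. -/
structure IsQuasiAbelian : Prop where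
  hasFiniteLimits : HasFiniteLimits C
  hasFiniteColimits : HasFiniteColimits C
  isKernelMap_of_isPushout : ∀ ⦃A B A' B' : C⦄ (i : A ⟶ B) (f : A ⟶ A') (f' : B ⟶ B')
    (i' : A' ⟶ B'), IsPushout i f f' i' → IsKernelMap i → IsKernelMap i'
  isCokernelMap_of_isPullback : ∀ ⦃A B A' B' : C⦄ (q' : A' ⟶ B') (f' : A' ⟶ A) (f : B' ⟶ B)
    (q : A ⟶ B), IsPullback f' q' q f → IsCokernelMap q → IsCokernelMap q'

/-- A complex is acyclic if its differentials factor as `K n ↠ Z (n + 1) ↪ K (n + 1)` in such a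
way that all the sequences `Z n ↪ K n ↠ Z (n + 1)` are short exact. -/
def IsAcyclic (K : CochainComplex C ℤ) : Prop :=
  ∃ (Z : ℤ → C) (m : ∀ n, Z n ⟶ K.X n) (e : ∀ n, K.X n ⟶ Z (n + 1)),
    ∀ n, K.d n (n + 1) = e n ≫ m (n + 1) ∧ IsKernelCokernelPair (m n) (e n)

variable [HasBinaryBiproducts C]

variable (C) in
/-- Quasi-isomorphisms in the homotopy category `K(C)`: homotopy classes of chain maps whose
mapping cone is acyclic. -/
def quasiIsos : MorphismProperty (HomotopyCategory C (ComplexShape.up ℤ)) :=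
  fun K L f => ∃ φ : K.as ⟶ L.as,
    (HomotopyCategory.quotient C (ComplexShape.up ℤ)).map φ = f ∧
      IsAcyclic (CochainComplex.mappingCone φ)

variable (C) in
/-- The derived category `D(C)`, the localization of `K(C)` at the quasi-isomorphisms. -/
noncomputable abbrev DerivedCat := (quasiIsos C).Localization

variable (C) in
/-- The localization functor from cochain complexes to the derived category. -/
noncomputable abbrev toDerived : CochainComplex C ℤ ⥤ DerivedCat C :=
  HomotopyCategory.quotient C (ComplexShape.up ℤ) ⋙ (quasiIsos C).Q

variable [HasZeroObject C]

/-- `Ext^n(A, B) = Hom_{D(C)}(A, B[n])`, for `n : ℤ`. -/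
noncomputable abbrev Ext (A B : C) (n : ℤ) :=
  (toDerived C).obj ((CochainComplex.singleFunctor C 0).obj A) ⟶
    (toDerived C).obj (((CochainComplex.singleFunctor C 0).obj B)⟦n⟧)

variable (C) in
/-- `d` is the homological dimension of `C`: the least `d : ℤ` such that `Ext^n(A, B) = 0` for
all `n > d` and all objects `A`, `B`. (A hom-group is zero iff it has at most one element.) -/
def IsHomologicalDimension (d : ℤ) : Prop :=
  IsLeast {d : ℤ | ∀ n : ℤ, d < n → ∀ A B : C, Subsingleton (Ext A B n)} d

end General

end QuasiAb

/-! ### Pro-`p` Polish abelian groups -/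

namespace ProP

section Groups

/-- Abelian (Polish) Lie groups: the groups isomorphic to `ℝⁿ ⊕ 𝕋ᵈ ⊕ D`, where `D` is countable and
discrete. -/
def IsLie (G : Type) [AddCommGroup G] [TopologicalSpace G] : Prop :=
  ∃ (n d : ℕ) (D : Type) (_ : AddCommGroup D) (_ : TopologicalSpace D),
    Countable D ∧ DiscreteTopology D ∧
      Nonempty (G ≃ₜ+ ((Fin n → ℝ) × (Fin d → UnitAddCircle) × D))

variable (G : Type) [AddCommGroup G] [TopologicalSpace G]

/-- Co-Lie subgroups: closed subgroups with Lie quotient. -/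
def IsCoLie {G : Type} [AddCommGroup G] [TopologicalSpace G] (N : AddSubgroup G) : Prop :=
  IsClosed (N : Set G) ∧ IsLie (G ⧸ N)

/-- Every zero neighborhood contains a co-Lie subgroup. -/
def IsProLie : Prop :=
  ∀ U ∈ 𝓝 (0 : G), ∃ N : AddSubgroup G, IsCoLie N ∧ (N : Set G) ⊆ U

/-- `p ^ n • x` converges to `0` for every `x`. For locally compact groups, this is the definition
of topological `p`-group. -/
def IsVanishing (p : ℕ) : Prop :=
  ∀ x : G, Tendsto (fun n : ℕ => p ^ n • x) atTop (𝓝 0)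

/-- Pro-`p` groups: pro-Lie groups `G` that are topological `p`-groups, i.e. the co-Lie subgroups
`N` such that the Lie group `G ⧸ N` is a topological `p`-group are cofinal among all the
co-Lie subgroups. -/
def IsProP (p : ℕ) : Prop :=
  IsProLie G ∧ ∀ M : AddSubgroup G, IsCoLie M →
    ∃ N : AddSubgroup G, IsCoLie N ∧ N ≤ M ∧ IsVanishing (G ⧸ N) p

end Groups

section Lemmas

theorem isVanishing_quotient {G : Type} [AddCommGroup G] [TopologicalSpace G] {p : ℕ}
    (h : IsVanishing G p) (N : AddSubgroup G) : IsVanishing (G ⧸ N) p := by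
  intro x
  obtain ⟨x, rfl⟩ := QuotientAddGroup.mk_surjective x
  have hc : Continuous (QuotientAddGroup.mk : G → G ⧸ N) := continuous_quotient_mk'
  exact (hc.tendsto 0).comp (h x)

/-- A pro-Lie group is a topological `p`-group iff `p ^ n • x` tends to `0` for every `x`. -/
theorem isProP_iff {G : Type} [AddCommGroup G] [TopologicalSpace G] [IsTopologicalAddGroup G]
    {p : ℕ} : IsProP G p ↔ IsProLie G ∧ IsVanishing G p := by
  refine ⟨fun ⟨h1, h2⟩ => ⟨h1, fun x => ?_⟩, fun ⟨h1, h2⟩ => ⟨h1, fun M hM =>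
    ⟨M, hM, le_rfl, isVanishing_quotient h2 M⟩⟩⟩
  rw [tendsto_def]
  intro U hU
  obtain ⟨V, hV, hVU⟩ := exists_nhds_zero_half hU
  obtain ⟨M, hM, hMV⟩ := h1 V hV
  obtain ⟨N, -, hNM, hN⟩ := h2 M hM
  have hopen : IsOpenMap (QuotientAddGroup.mk : G → G ⧸ N) := QuotientAddGroup.isOpenMap_coe
  have := hN (x : G ⧸ N) (hopen.image_mem_nhds hV)
  filter_upwards [this] with n hn
  obtain ⟨v, hv, hvn⟩ := hn
  have h3 : -v + p ^ n • x ∈ N := by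
    rw [← QuotientAddGroup.eq]; exact hvn
  have := hVU v hv _ (hMV (hNM h3))
  simpa using this

theorem isLie_of_equiv {G H : Type} [AddCommGroup G] [TopologicalSpace G] [AddCommGroup H]
    [TopologicalSpace H] (e : G ≃ₜ+ H) (h : IsLie H) : IsLie G := by
  obtain ⟨n, d, D, i1, i2, h1, h2, ⟨f⟩⟩ := h
  exact ⟨n, d, D, i1, i2, h1, h2, ⟨e.trans f⟩⟩

/-- `X^m × X^n ≃ X^(m + n)`. -/
def finAppend (X : Type) [AddCommGroup X] [TopologicalSpace X] (m n : ℕ) :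
    (Fin m → X) × (Fin n → X) ≃ₜ+ (Fin (m + n) → X) where
  toFun f := Fin.append f.1 f.2
  invFun f := (fun i => f (Fin.castAdd n i), fun i => f (Fin.natAdd m i))
  left_inv f := by ext i <;> simp
  right_inv f := by
    ext i
    refine Fin.addCases (fun i => ?_) (fun i => ?_) i <;> simp
  map_add' f g := by
    ext i
    refine Fin.addCases (fun i => ?_) (fun i => ?_) i <;> simp
  continuous_toFun := by
    refine continuous_pi fun i => ?_
    refine Fin.addCases (fun i => ?_) (fun i => ?_) i <;> simp <;> fun_prop
  continuous_invFun := by fun_prop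

theorem isLie_prod {G H : Type} [AddCommGroup G] [TopologicalSpace G] [AddCommGroup H]
    [TopologicalSpace H] (hG : IsLie G) (hH : IsLie H) : IsLie (G × H) := by
  obtain ⟨n, d, D, i1, i2, h1, h2, ⟨f⟩⟩ := hG
  obtain ⟨n', d', D', i1', i2', h1', h2', ⟨f'⟩⟩ := hH
  let a := finAppend ℝ n n'
  let b := finAppend UnitAddCircle d d'
  refine ⟨n + n', d + d', D × D', inferInstance, inferInstance, inferInstance, inferInstance,
    ⟨{ toFun := fun x => (a ((f x.1).1, (f' x.2).1), b ((f x.1).2.1, (f' x.2).2.1),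
          ((f x.1).2.2, (f' x.2).2.2))
       invFun := fun y => (f.symm ((a.symm y.1).1, (b.symm y.2.1).1, y.2.2.1),
          f'.symm ((a.symm y.1).2, (b.symm y.2.1).2, y.2.2.2))
       left_inv := fun x => by simp
       right_inv := fun y => by simp
       map_add' := fun x y => by
        simp only [Prod.fst_add, Prod.snd_add, map_add, ← Prod.mk_add_mk]
       continuous_toFun := ?_
       continuous_invFun := ?_ }⟩⟩
  · have hf := f.continuous
    have hf' := f'.continuous
    have ha := a.continuous
    have hb := b.continuous
    exact (ha.comp (((hf.comp continuous_fst).fst).prodMk ((hf'.comp continuous_snd).fst))).prodMk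
      ((hb.comp (((hf.comp continuous_fst).snd.fst).prodMk
        ((hf'.comp continuous_snd).snd.fst))).prodMk
        (((hf.comp continuous_fst).snd.snd).prodMk ((hf'.comp continuous_snd).snd.snd)))
  · have hf := f.symm.continuous
    have hf' := f'.symm.continuous
    have ha := a.symm.continuous
    have hb := b.symm.continuous
    have ha1 := ha.comp (continuous_fst (X := Fin (n + n') → ℝ)
      (Y := (Fin (d + d') → UnitAddCircle) × (D × D')))
    have hb1 := hb.comp (continuous_fst.comp (continuous_snd (X := Fin (n + n') → ℝ)
      (Y := (Fin (d + d') → UnitAddCircle) × (D × D'))))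
    exact (hf.comp (ha1.fst.prodMk (hb1.fst.prodMk continuous_snd.snd.fst))).prodMk
      (hf'.comp (ha1.snd.prodMk (hb1.snd.prodMk continuous_snd.snd.snd)))

/-- `(G × H) / (M × N) ≃ (G / M) × (H / N)`, topologically. -/
theorem nonempty_quotient_prod {G H : Type} [AddCommGroup G] [TopologicalSpace G]
    [IsTopologicalAddGroup G] [AddCommGroup H] [TopologicalSpace H] [IsTopologicalAddGroup H]
    (M : AddSubgroup G) (N : AddSubgroup H) :
    Nonempty ((G × H) ⧸ M.prod N ≃ₜ+ (G ⧸ M) × (H ⧸ N)) := by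
  let φ : G × H →+ (G ⧸ M) × (H ⧸ N) :=
    (QuotientAddGroup.mk' M).prodMap (QuotientAddGroup.mk' N)
  have hφ : ∀ x, φ x = ((x.1 : G ⧸ M), (x.2 : H ⧸ N)) := fun x => rfl
  have hker : φ.ker = M.prod N := by
    ext x
    simp [AddMonoidHom.mem_ker, hφ, AddSubgroup.mem_prod, Prod.ext_iff]
  have hsurj : Function.Surjective φ := by
    rintro ⟨x, y⟩
    obtain ⟨x, rfl⟩ := QuotientAddGroup.mk_surjective x
    obtain ⟨y, rfl⟩ := QuotientAddGroup.mk_surjective y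
    exact ⟨(x, y), rfl⟩
  have hopen : IsOpenMap φ :=
    (QuotientAddGroup.isOpenMap_coe (N := M)).prodMap (QuotientAddGroup.isOpenMap_coe (N := N))
  have hcont : Continuous φ :=
    (continuous_quotient_mk' : Continuous (QuotientAddGroup.mk : G → G ⧸ M)).prodMap
      (continuous_quotient_mk' : Continuous (QuotientAddGroup.mk : H → H ⧸ N))
  rw [← hker]
  let e := QuotientAddGroup.quotientKerEquivOfSurjective φ hsurj
  have he : ∀ x : G × H, e x = φ x := fun x => rfl
  have hq : IsQuotientMap (QuotientAddGroup.mk : G × H → (G × H) ⧸ φ.ker) :=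
    isQuotientMap_quotient_mk'
  have hec : Continuous e := hq.continuous_iff.2 hcont
  have heo : IsOpenMap e := by
    intro U hU
    have : e '' U = φ '' (QuotientAddGroup.mk ⁻¹' U) := by
      ext y
      constructor
      · rintro ⟨x, hx, rfl⟩
        obtain ⟨x, rfl⟩ := QuotientAddGroup.mk_surjective x
        exact ⟨x, hx, rfl⟩
      · rintro ⟨x, hx, rfl⟩
        exact ⟨x, hx, rfl⟩
    rw [this]
    exact hopen _ (hU.preimage hq.continuous)
  exact ⟨{ e with
    continuous_toFun := hec
    continuous_invFun := (e.toEquiv.toHomeomorphOfContinuousOpen hec heo).symm.continuous }⟩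

theorem isProP_prod {G H : Type} [AddCommGroup G] [TopologicalSpace G]
    [IsTopologicalAddGroup G] [AddCommGroup H] [TopologicalSpace H] [IsTopologicalAddGroup H]
    {p : ℕ} (hG : IsProP G p) (hH : IsProP H p) : IsProP (G × H) p := by
  rw [isProP_iff] at *
  refine ⟨fun U hU => ?_, fun x => ?_⟩
  · rw [show (0 : G × H) = (0, 0) from rfl, nhds_prod_eq, mem_prod_iff] at hU
    obtain ⟨V, hV, W, hW, hVW⟩ := hU
    obtain ⟨M, ⟨hMc, hM⟩, hMV⟩ := hG.1 V hV
    obtain ⟨N, ⟨hNc, hN⟩, hNW⟩ := hH.1 W hW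
    obtain ⟨e⟩ := nonempty_quotient_prod M N
    refine ⟨M.prod N, ⟨?_, isLie_of_equiv e (isLie_prod hM hN)⟩, ?_⟩
    · rw [AddSubgroup.coe_prod]; exact hMc.prod hNc
    · rw [AddSubgroup.coe_prod]; exact (Set.prod_mono hMV hNW).trans hVW
  · exact (hG.2 x.1).prodMk_nhds (hH.2 x.2)

theorem isLie_of_countable_discrete (G : Type) [AddCommGroup G] [TopologicalSpace G] [Countable G]
    [DiscreteTopology G] : IsLie G :=
  ⟨0, 0, G, inferInstance, inferInstance, inferInstance, inferInstance,
    ⟨{ toFun := fun x => (0, 0, x)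
       invFun := fun x => x.2.2
       left_inv := fun x => rfl
       right_inv := fun x => by ext i <;> first | exact i.elim0 | rfl
       map_add' := fun x y => by simp
       continuous_toFun := by fun_prop
       continuous_invFun := by fun_prop }⟩⟩

theorem isProP_punit (p : ℕ) : IsProP PUnit.{1} p := by
  rw [isProP_iff]
  refine ⟨fun U hU => ⟨⊥, ⟨isClosed_discrete _, ?_⟩, ?_⟩, fun x => ?_⟩
  · have : Countable (PUnit.{1} ⧸ (⊥ : AddSubgroup PUnit.{1})) :=
      QuotientAddGroup.mk_surjective.countable
    have : DiscreteTopology (PUnit.{1} ⧸ (⊥ : AddSubgroup PUnit.{1})) :=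
      QuotientAddGroup.discreteTopology (isOpen_discrete _)
    exact isLie_of_countable_discrete _
  · intro x _
    exact mem_of_mem_nhds hU
  · exact tendsto_const_nhds.congr fun _ => rfl

end Lemmas

/-- The objects of `PAb(p)`. -/
structure PAb (p : ℕ) : Type 1 where
  /-- The underlying group. -/
  carrier : Type
  [addCommGroup : AddCommGroup carrier]
  [topologicalSpace : TopologicalSpace carrier]
  [isTopologicalAddGroup : IsTopologicalAddGroup carrier]
  [polishSpace : PolishSpace carrier]
  isProP : IsProP carrier p

namespace PAb

variable {p : ℕ}

instance : CoeSort (PAb p) Type := ⟨carrier⟩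

attribute [instance] addCommGroup topologicalSpace isTopologicalAddGroup polishSpace

/-- Morphisms are the continuous group homomorphisms. -/
instance : Category (PAb p) where
  Hom A B := A →ₜ+ B
  id A := ContinuousAddMonoidHom.id A
  comp f g := ContinuousAddMonoidHom.comp g f

instance : ConcreteCategory (PAb p) (fun A B => A →ₜ+ B) where
  hom f := f
  ofHom f := f

/-- Pointwise addition of morphisms. -/
instance : Preadditive (PAb p) where
  homGroup A B := inferInstanceAs (AddCommGroup (A →ₜ+ B))
  add_comp A B D f f' g := ContinuousAddMonoidHom.ext fun x =>
    map_add (show B →ₜ+ D from g) ((show A →ₜ+ B from f) x) ((show A →ₜ+ B from f') x)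
  comp_add _ _ _ _ _ _ := rfl

instance : HasZeroObject (PAb p) where
  zero := by
    let Z : PAb p := ⟨PUnit.{1}, isProP_punit p⟩
    have : 𝟙 Z = 0 := rfl
    exact ⟨Z, (IsZero.iff_id_eq_zero Z).2 this⟩

/-- The product group. -/
def prod (A B : PAb p) : PAb p := ⟨A × B, isProP_prod A.isProP B.isProP⟩

instance : HasBinaryBiproducts (PAb p) where
  has_binary_biproduct A B := by
    let b : BinaryBicone A B :=
      { pt := prod A B
        fst := ContinuousAddMonoidHom.fst A B
        snd := ContinuousAddMonoidHom.snd A B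
        inl := ContinuousAddMonoidHom.inl A B
        inr := ContinuousAddMonoidHom.inr A B
        inl_fst := rfl
        inl_snd := rfl
        inr_fst := rfl
        inr_snd := rfl }
    refine HasBinaryBiproduct.mk ⟨b, isBinaryBilimitOfTotal b ?_⟩
    refine ContinuousAddMonoidHom.ext fun (x : A × B) => ?_
    change (x.1, (0 : B)) + ((0 : A), x.2) = x
    simp

end PAb

/-! ### The group `(ℤ(p^∞)^(ω))^ω` -/

/-- The Prüfer group `ℤ(p^∞)`, as the `p`-primary part of `ℚ / ℤ`. -/
def pruferSubgroup (p : ℕ) : AddSubgroup (ℚ ⧸ (Int.castAddHom ℚ).range) where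
  carrier := {x | ∃ n : ℕ, p ^ n • x = 0}
  zero_mem' := ⟨0, smul_zero _⟩
  neg_mem' := by
    rintro x ⟨n, hn⟩
    exact ⟨n, by rw [smul_neg, hn, neg_zero]⟩
  add_mem' := by
    rintro x y ⟨n, hn⟩ ⟨m, hm⟩
    exact ⟨n + m, by rw [smul_add, pow_add, mul_smul, mul_smul, hm, smul_zero, add_zero,
      ← mul_smul, mul_comm, mul_smul, hn, smul_zero]⟩

/-- The direct sum `ℤ(p^∞)^(ω)` of countably many copies of the Prüfer group, as a discrete
group. -/
def PruferSum (p : ℕ) : Type := ℕ →₀ pruferSubgroup p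

noncomputable instance (p : ℕ) : AddCommGroup (PruferSum p) := inferInstanceAs (AddCommGroup (ℕ →₀ _))

instance (p : ℕ) : TopologicalSpace (PruferSum p) := ⊥

instance (p : ℕ) : DiscreteTopology (PruferSum p) := ⟨rfl⟩

end ProP

/-! The condition $p^n x\to 0$ removes the connected part of the Lie quotients: it fails at
$1\in\mathbb{R}$ and at a point of order $p+1$ in $\mathbb{T}$. So co-Lie subgroups are open, and
pro-$p$ groups are exactly the nonarchimedean Polish groups with $p^n x\to 0$
(`isProP_of_nonarchimedean`, `IsProP.nonarchimedeanAddGroup`). Complete images and the open mapping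
theorem then identify kernels with closed embeddings and cokernels with surjections
(`isKernelMap_iff`, `isCokernelMap_iff`), which reduces the quasi-abelian axioms to explicit fibre
products and quotients.

For injectivity, a continuous map to a discrete divisible group kills an open subgroup, so its
extension is a purely algebraic problem, solved by Baer's criterion; products follow coordinatewise.
Conversely, if the open subgroups $U_n$ form a basis at $0$, each $A/U_n$ is a countable $p$-group,
hence embeds in $\mathbb{Z}(p^\infty)^{(\omega)}$, and together these maps embed $A$ in the
countable power. A quotient of an injective is a quotient of that power. It inherits a basis of open
divisible subgroups, the images of the tails, and therefore splits as the product of the discrete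
divisible groups $U_n/U_{n+1}$ (`isInjective_of_basis`).

Every object thus has an injective resolution of length one. Maps in $\mathrm{D}$ into a two-term
complex of injectives are homotopy classes of chain maps (`IsTwoTermInjective.bijective_map`), so
$\mathrm{Ext}^n=0$ for $n>1$ by degree reasons. If $\mathrm{Ext}^1$ vanished too, the resolution of
$\mathbb{Z}/p$ would split, making $\mathbb{Z}/p$ a quotient of a divisible group. -/

namespace PolishAddGroup

/-! ### Polish abelian groups: completeness, closed images, open mappings -/

/-- A completely metrizable space is a `Gδ` in any Hausdorff space in which it is dense. -/
theorem isGδ_range_of_isDenseInducing {X Y : Type*} [TopologicalSpace X]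
    [TopologicalSpace.IsCompletelyMetrizableSpace X] [TopologicalSpace Y] [T2Space Y] {f : X → Y}
    (hf : IsDenseInducing f) : IsGδ (Set.range f) := by
  let := TopologicalSpace.upgradeIsCompletelyMetrizable X
  let W : ℕ → Set Y := fun n =>
    ⋃₀ {O | IsOpen O ∧ ∀ x y, f x ∈ O → f y ∈ O → dist x y < 1 / ((n : ℝ) + 1)}
  have hW : Set.range f = ⋂ n, W n := by
    apply Set.Subset.antisymm
    · rintro _ ⟨x, rfl⟩
      refine Set.mem_iInter.2 fun n => ?_
      have hn : (0 : ℝ) < 1 / ((n : ℝ) + 1) := by positivity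
      obtain ⟨O, hO, hOx⟩ := hf.isInducing.isOpen_iff.1
        (Metric.isOpen_ball (x := x) (ε := 1 / ((n : ℝ) + 1) / 2))
      have hmem : ∀ z, f z ∈ O ↔ dist z x < 1 / ((n : ℝ) + 1) / 2 := fun z => by
        rw [← Set.mem_preimage, hOx, Metric.mem_ball]
      refine ⟨O, ⟨hO, fun a b ha hb => ?_⟩, (hmem x).2 (by rw [dist_self]; positivity)⟩
      have h1 := (hmem a).1 ha
      have h2 := (hmem b).1 hb
      have := dist_triangle_right a b x
      linarith
    · intro z hz
      rw [Set.mem_iInter] at hz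
      have hne : (comap f (𝓝 z)).NeBot := hf.comap_nhds_neBot z
      have hc : Cauchy (comap f (𝓝 z)) := by
        rw [Metric.cauchy_iff]
        refine ⟨hne, fun ε hε => ?_⟩
        obtain ⟨n, hn⟩ := exists_nat_one_div_lt hε
        obtain ⟨O, ⟨hO, hOd⟩, hzO⟩ := hz n
        exact ⟨f ⁻¹' O, preimage_mem_comap (hO.mem_nhds hzO), fun x hx y hy =>
          (hOd x y hx hy).trans hn⟩
      obtain ⟨x, hx⟩ := CompleteSpace.complete hc
      refine ⟨x, tendsto_nhds_unique (f := f) (l := comap f (𝓝 z)) ?_ tendsto_comap⟩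
      exact (hf.continuous.tendsto x).mono_left hx
  rw [hW]
  exact IsGδ.iInter_of_isOpen fun n => isOpen_sUnion fun _ hO => hO.1

/-- In the completion, `G` and its reflection `z - G` are both dense `Gδ` sets, so by Baire they
meet; this writes `z` as a sum of two elements of `G`. -/
theorem completeSpace_of_isUniformAddGroup {G : Type*} [AddCommGroup G] [UniformSpace G]
    [IsUniformAddGroup G] [TopologicalSpace.IsCompletelyMetrizableSpace G] : CompleteSpace G := by
  have : (uniformity G).IsCountablyGenerated :=
    IsUniformAddGroup.uniformity_countably_generated
  let : MetricSpace G := UniformSpace.metricSpace G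
  have hd := UniformSpace.Completion.isDenseInducing_coe (α := G)
  have hG := isGδ_range_of_isDenseInducing hd
  rw [UniformSpace.Completion.isUniformInducing_coe (α := G) |>.completeSpace_congr ?_]
  · infer_instance
  intro z
  let σ : UniformSpace.Completion G ≃ₜ UniformSpace.Completion G := Homeomorph.subLeft z
  have h2 : IsGδ (σ ⁻¹' Set.range ((↑) : G → UniformSpace.Completion G)) :=
    hG.preimage σ.continuous
  have h3 : Dense (σ ⁻¹' Set.range ((↑) : G → UniformSpace.Completion G)) :=
    Dense.preimage hd.dense σ.isOpenMap
  obtain ⟨w, ⟨x, hx⟩, ⟨y, hy⟩⟩ := (hd.dense.inter_of_Gδ hG h2 h3).nonempty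
  refine ⟨x + y, ?_⟩
  rw [UniformSpace.Completion.coe_add, hx, hy]
  simp [σ]

section

variable (G : Type*) [AddCommGroup G] [TopologicalSpace G] [IsTopologicalAddGroup G]

instance completeSpace_rightUniformSpace [PolishSpace G] :
    @CompleteSpace G (IsTopologicalAddGroup.rightUniformSpace G) := by
  let := IsTopologicalAddGroup.rightUniformSpace G
  have : IsUniformAddGroup G := isUniformAddGroup_of_addCommGroup
  exact completeSpace_of_isUniformAddGroup

variable {G}

theorem polishSpace_quotient [PolishSpace G] (N : AddSubgroup G) (hN : IsClosed (N : Set G)) :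
    PolishSpace (G ⧸ N) := by
  let : UniformSpace (G ⧸ N) := IsTopologicalAddGroup.rightUniformSpace (G ⧸ N)
  have : IsUniformAddGroup (G ⧸ N) := isUniformAddGroup_of_addCommGroup
  have : CompleteSpace (G ⧸ N) := QuotientAddGroup.completeSpace_right' G N
  have : T3Space (G ⧸ N) := by
    have : IsClosed (N : Set G) := hN
    infer_instance
  have : SecondCountableTopology (G ⧸ N) :=
    (QuotientAddGroup.isOpenQuotientMap_mk (N := N)).isQuotientMap.secondCountableTopology
      QuotientAddGroup.isOpenMap_coe
  have : (uniformity (G ⧸ N)).IsCountablyGenerated :=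
    IsUniformAddGroup.uniformity_countably_generated
  infer_instance

variable {H : Type*} [AddCommGroup H] [TopologicalSpace H] [IsTopologicalAddGroup H]

/-- An inducing homomorphism is automatically uniformly inducing, so its image is complete, hence
closed. -/
theorem isClosedEmbedding_of_isInducing [PolishSpace G] [T2Space H] (f : G →+ H)
    (hf : IsInducing f) : IsClosedEmbedding f := by
  let := IsTopologicalAddGroup.rightUniformSpace G
  have : IsUniformAddGroup G := isUniformAddGroup_of_addCommGroup
  let := IsTopologicalAddGroup.rightUniformSpace H
  have : IsUniformAddGroup H := isUniformAddGroup_of_addCommGroup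
  have : CompleteSpace G := completeSpace_of_isUniformAddGroup
  have hu : IsUniformInducing f := by
    refine ⟨?_⟩
    rw [uniformity_eq_comap_nhds_zero, uniformity_eq_comap_nhds_zero, comap_comap]
    have : 𝓝 (0 : G) = comap f (𝓝 0) := by rw [hf.nhds_eq_comap, map_zero]
    rw [this, comap_comap]
    congr 1
    ext x
    simp
  refine ⟨hf.isEmbedding, ?_⟩
  exact (hu.isComplete_range).isClosed

theorem countable_quotient_of_isOpen [SecondCountableTopology G] (N : AddSubgroup G)
    (hN : IsOpen (N : Set G)) : Countable (G ⧸ N) := by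
  have : DiscreteTopology (G ⧸ N) := QuotientAddGroup.discreteTopology hN
  have : SecondCountableTopology (G ⧸ N) :=
    (QuotientAddGroup.isOpenQuotientMap_mk (N := N)).isQuotientMap.secondCountableTopology
      QuotientAddGroup.isOpenMap_coe
  exact TopologicalSpace.separableSpace_iff_countable.1 inferInstance

/-- A decreasing basis of neighborhoods of zero consisting of open subgroups. -/
theorem exists_antitone_basis_addSubgroup {G : Type*} [AddCommGroup G] [TopologicalSpace G]
    [FirstCountableTopology G] [NonarchimedeanAddGroup G] :
    ∃ U : ℕ → AddSubgroup G, Antitone U ∧ (∀ n, IsOpen (U n : Set G)) ∧ U 0 = ⊤ ∧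
      (𝓝 (0 : G)).HasBasis (fun _ => True) fun n => (U n : Set G) := by
  obtain ⟨B, hB⟩ := (𝓝 (0 : G)).exists_antitone_basis
  choose V hV using fun n => NonarchimedeanAddGroup.is_nonarchimedean (B n) (hB.mem n)
  obtain ⟨U, hU0, hU⟩ : ∃ U : ℕ → AddSubgroup G, U 0 = ⊤ ∧
      ∀ n, U (n + 1) = U n ⊓ (V n).toAddSubgroup :=
    ⟨fun n => Nat.rec ⊤ (fun k W => W ⊓ (V k).toAddSubgroup) n, rfl, fun _ => rfl⟩
  have ho : ∀ n, IsOpen (U n : Set G) := by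
    intro n
    induction n with
    | zero => rw [hU0]; exact isOpen_univ
    | succ n ih => rw [hU, AddSubgroup.coe_inf]; exact ih.inter (V n).isOpen
  refine ⟨U, antitone_nat_of_succ_le fun n => (hU n).trans_le inf_le_left, ho, hU0, ?_⟩
  refine hB.1.to_hasBasis (fun n _ => ⟨n + 1, trivial, ?_⟩) fun n _ => ?_
  · rw [hU]
    exact (Set.inter_subset_right).trans (hV n)
  · exact (hB.1.mem_iff.1 ((ho n).mem_nhds (U n).zero_mem))

/-- The closures of the images of open subgroups are open, by the Baire category theorem. -/
theorem isOpen_topologicalClosure_map [SecondCountableTopology G] [BaireSpace H] (f : G →+ H)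
    (hf : Function.Surjective f) (U : AddSubgroup G) (hU : IsOpen (U : Set G)) :
    IsOpen ((U.map f).topologicalClosure : Set H) := by
  have := countable_quotient_of_isOpen U hU
  let K := (U.map f).topologicalClosure
  -- Countably many translates of the closed subgroup `K` cover `H`, so one of them, hence `K`, has
  -- interior.
  have hcov : ⋃ q : G ⧸ U, (fun h => f q.out + h) '' (K : Set H) = Set.univ := by
    refine Set.eq_univ_of_forall fun h => ?_
    obtain ⟨g, rfl⟩ := hf h
    refine Set.mem_iUnion.2 ⟨(g : G ⧸ U), f (-(g : G ⧸ U).out + g), ?_, by simp⟩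
    exact AddSubgroup.le_topologicalClosure _ ⟨_, QuotientAddGroup.eq.1 (by simp), rfl⟩
  obtain ⟨q, hq⟩ := nonempty_interior_of_iUnion_of_closed (fun q : G ⧸ U =>
    (Homeomorph.addLeft (f q.out)).isClosedMap _
      (AddSubgroup.isClosed_topologicalClosure (U.map f))) hcov
  rw [Homeomorph.coe_addLeft] at hq
  rw [← Homeomorph.coe_addLeft, ← Homeomorph.image_interior] at hq
  obtain ⟨_, x, hx, -⟩ := hq
  exact AddSubgroup.isOpen_of_mem_nhds _ (mem_interior_iff_mem_nhds.1 hx)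

/-- Open mapping theorem for nonarchimedean Polish groups. -/
theorem isOpenMap_of_surjective {G : Type*} [AddCommGroup G] [TopologicalSpace G] [PolishSpace G]
    [NonarchimedeanAddGroup G] [PolishSpace H] (f : G →+ H) (hc : Continuous f)
    (hf : Function.Surjective f) : IsOpenMap f := by
  let := IsTopologicalAddGroup.rightUniformSpace G
  have : IsUniformAddGroup G := isUniformAddGroup_of_addCommGroup
  have : CompleteSpace G := completeSpace_of_isUniformAddGroup
  obtain ⟨U, hanti, hUo, -, hU⟩ := exists_antitone_basis_addSubgroup (G := G)
  let K : ℕ → AddSubgroup H := fun n => ((U n).map f).topologicalClosure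
  have hKo : ∀ n, IsOpen (K n : Set H) := fun n => isOpen_topologicalClosure_map f hf (U n) (hUo n)
  have hstep : ∀ n y, y ∈ K n → ∃ x ∈ U n, y - f x ∈ K (n + 1) := by
    intro n y hy
    have hnhds : {z | y - z ∈ K (n + 1)} ∈ 𝓝 y := by
      refine (((hKo (n + 1)).preimage (continuous_const.sub continuous_id)).mem_nhds ?_)
      simp
    obtain ⟨_, hz, x, hx, rfl⟩ := mem_closure_iff_nhds.1 hy _ hnhds
    exact ⟨x, hx, hz⟩
  choose! s hs hs' using hstep
  have himg : ∀ n, (K n : Set H) ⊆ f '' (U n) := by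
    intro N y hy
    -- Successive approximation: `r k` is the error left after `k` corrections, the next of which
    -- lies in `U (N + k)`. The corrections sum to a preimage of `y` inside `U N`, since open
    -- subgroups are closed.
    let r : ℕ → H := fun k => k.rec y fun k z => z - f (s (N + k) z)
    have hr : ∀ k, r (k + 1) = r k - f (s (N + k) (r k)) := fun k => rfl
    have hrK : ∀ k, r k ∈ K (N + k) := by
      intro k
      induction k with
      | zero => exact hy
      | succ k ih => rw [hr]; exact hs' _ _ ih
    let x : ℕ → G := fun k => s (N + k) (r k)
    have hx : ∀ k, x k ∈ U (N + k) := fun k => hs _ _ (hrK k)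
    let S : ℕ → G := fun k => ∑ i ∈ Finset.range k, x i
    have hfS : ∀ k, f (S k) = y - r k := by
      intro k
      induction k with
      | zero => simp [S, r]
      | succ k ih =>
        have : S (k + 1) = S k + x k := Finset.sum_range_succ _ _
        rw [this, map_add, ih, hr]; abel
    have hdiff : ∀ k j, S (k + j) - S k ∈ U (N + k) := by
      intro k j
      induction j with
      | zero => simp
      | succ j ih =>
        have : S (k + (j + 1)) - S k = (S (k + j) - S k) + x (k + j) := by
          have : S (k + j + 1) = S (k + j) + x (k + j) := Finset.sum_range_succ _ _
          rw [← add_assoc, this]; abel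
        rw [this]
        exact add_mem ih (hanti (by omega) (hx (k + j)))
    have hcau : CauchySeq S := by
      rw [cauchySeq_iff]
      intro V hV
      rw [uniformity_eq_comap_nhds_zero] at hV
      obtain ⟨T, hT, hTV⟩ := hV
      obtain ⟨n, -, hn⟩ := hU.mem_iff.1 hT
      refine ⟨n, fun k hk l hl => hTV (hn ?_)⟩
      obtain ⟨k, rfl⟩ := Nat.exists_eq_add_of_le hk
      obtain ⟨l, rfl⟩ := Nat.exists_eq_add_of_le hl
      have h1 := hanti (show n ≤ N + n by omega) (hdiff n k)
      have h2 := hanti (show n ≤ N + n by omega) (hdiff n l)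
      have := sub_mem h2 h1
      rwa [sub_sub_sub_cancel_right] at this
    obtain ⟨g, hg⟩ := cauchySeq_tendsto_of_complete hcau
    have hgU : g ∈ U N := by
      have hcl : IsClosed (U N : Set G) := AddSubgroup.isClosed_of_isOpen _ (hUo N)
      refine hcl.mem_of_tendsto hg (Eventually.of_forall fun k => ?_)
      simpa [S] using hdiff 0 k
    refine ⟨g, hgU, ?_⟩
    -- Continuity of `f` puts `K n` inside any given closed neighborhood of zero once `n` is large.
    have hr0 : Tendsto r atTop (𝓝 0) := by
      rw [(closed_nhds_basis (0 : H)).tendsto_right_iff]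
      rintro V ⟨hV, hVc⟩
      have : f ⁻¹' V ∈ 𝓝 (0 : G) := hc.continuousAt.preimage_mem_nhds (by rwa [map_zero])
      obtain ⟨n, -, hn⟩ := hU.mem_iff.1 this
      filter_upwards [eventually_ge_atTop n] with k hk
      have hKV : (K n : Set H) ⊆ V := closure_minimal (Set.image_subset_iff.2 hn) hVc
      refine hKV (closure_mono (Set.image_mono ?_) (hrK k))
      exact hanti (by omega)
    have h1 : Tendsto (fun k => f (S k)) atTop (𝓝 (y - 0)) := by
      simp_rw [hfS]
      exact tendsto_const_nhds.sub hr0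
    rw [sub_zero] at h1
    exact tendsto_nhds_unique ((hc.tendsto g).comp hg) h1
  refine (IsOpenMap.of_nhds_le ?_)
  intro g
  rw [← map_add_left_nhds_zero (f g), ← map_add_left_nhds_zero g, map_map]
  have : (f ∘ fun x => g + x) = (fun y => f g + y) ∘ f := by ext x; simp
  rw [this, ← map_map]
  refine map_mono ((hU.map f).ge_iff.2 fun n _ => ?_)
  exact mem_of_superset ((hKo n).mem_nhds (K n).zero_mem) (himg n)

end

end PolishAddGroup

/-! ### Pro-$p$ groups as nonarchimedean groups -/

namespace ProP

section Groups

variable {G : Type} [AddCommGroup G] [TopologicalSpace G]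

theorem IsVanishing.of_surjective {H : Type} [AddCommGroup H] [TopologicalSpace H] {p : ℕ}
    (h : IsVanishing G p) (f : G →+ H) (hc : Continuous f) (hf : Function.Surjective f) :
    IsVanishing H p := by
  intro y
  obtain ⟨x, rfl⟩ := hf y
  have := (hc.tendsto 0).comp (h x)
  rw [map_zero] at this
  exact this.congr fun n => by simp

theorem IsVanishing.of_isInducing {H : Type} [AddCommGroup H] [TopologicalSpace H] {p : ℕ}
    (h : IsVanishing H p) (f : G →+ H) (hf : IsInducing f) : IsVanishing G p := by
  intro x
  rw [hf.tendsto_nhds_iff, map_zero]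
  exact (h (f x)).congr fun n => by simp

theorem not_isVanishing_real {p : ℕ} (hp : 1 ≤ p) : ¬ IsVanishing ℝ p := by
  intro h
  have h1 := (h 1).eventually (gt_mem_nhds (zero_lt_one (α := ℝ)))
  obtain ⟨n, hn⟩ := h1.exists
  have : (1 : ℝ) ≤ (p : ℝ) ^ n := one_le_pow₀ (by exact_mod_cast hp)
  simp only [nsmul_eq_mul, mul_one, Nat.cast_pow] at hn
  linarith

theorem not_isVanishing_unitAddCircle {p : ℕ} (hp : 1 ≤ p) : ¬ IsVanishing UnitAddCircle p := by
  intro h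
  -- On a point of order `p + 1`, multiplication by `p` is negation, so the even powers of `p` fix
  -- it.
  let x : UnitAddCircle := ((1 / ((p + 1 : ℕ) : ℝ) * 1 : ℝ) : UnitAddCircle)
  have ho : addOrderOf x = p + 1 := by
    simpa [x] using AddCircle.addOrderOf_period_div (p := (1 : ℝ)) (n := p + 1) (by omega)
  have hx : p • x = -x := by
    rw [eq_neg_iff_add_eq_zero, ← succ_nsmul, ← ho, addOrderOf_nsmul_eq_zero]
  have hx2 : ∀ n, p ^ (2 * n) • x = x := by
    intro n
    induction n with
    | zero => simp
    | succ n ih =>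
      rw [show p ^ (2 * (n + 1)) = p ^ (2 * n) * (p * p) by ring, mul_smul, mul_smul, hx,
        smul_neg, hx, neg_neg, ih]
  have h1 : Tendsto (fun n : ℕ => p ^ (2 * n) • x) atTop (𝓝 0) :=
    (h x).comp (tendsto_id.const_mul_atTop' (by norm_num))
  simp_rw [hx2] at h1
  have h0 : x = 0 := tendsto_nhds_unique tendsto_const_nhds h1
  rw [h0, addOrderOf_zero] at ho
  omega

/-- Vanishing passes to each coordinate of `ℝⁿ` and `𝕋ᵈ`, where it fails, so `n = d = 0`. For `p =
0` every group would be vanishing. -/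
theorem IsLie.discreteTopology {p : ℕ} (hp : 1 ≤ p) (h : IsLie G) (hv : IsVanishing G p) :
    DiscreteTopology G := by
  obtain ⟨n, d, D, _, _, _, _, ⟨e⟩⟩ := h
  have hv' : IsVanishing ((Fin n → ℝ) × (Fin d → UnitAddCircle) × D) p :=
    hv.of_surjective e.toAddMonoidHom e.continuous e.surjective
  have hn : IsEmpty (Fin n) := by
    refine ⟨fun i => not_isVanishing_real hp ?_⟩
    exact hv'.of_surjective ((Pi.evalAddMonoidHom _ i).comp (AddMonoidHom.fst _ _))
      ((continuous_apply i).comp continuous_fst) fun x => ⟨(fun _ => x, 0), rfl⟩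
  have hd : IsEmpty (Fin d) := by
    refine ⟨fun i => not_isVanishing_unitAddCircle hp ?_⟩
    exact hv'.of_surjective ((Pi.evalAddMonoidHom _ i).comp
      ((AddMonoidHom.fst _ _).comp (AddMonoidHom.snd _ _)))
      ((continuous_apply i).comp (continuous_fst.comp continuous_snd))
      fun x => ⟨(0, fun _ => x, 0), rfl⟩
  exact e.toHomeomorph.isEmbedding.discreteTopology

theorem isProP_of_nonarchimedean [NonarchimedeanAddGroup G] [SecondCountableTopology G] {p : ℕ}
    (hv : IsVanishing G p) : IsProP G p := by
  rw [isProP_iff]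
  refine ⟨fun U hU => ?_, hv⟩
  obtain ⟨N, hN⟩ := NonarchimedeanAddGroup.is_nonarchimedean U hU
  have := PolishAddGroup.countable_quotient_of_isOpen N.toAddSubgroup N.isOpen
  have : DiscreteTopology (G ⧸ N.toAddSubgroup) := QuotientAddGroup.discreteTopology N.isOpen
  exact ⟨N.toAddSubgroup, ⟨N.isClosed, isLie_of_countable_discrete _⟩, hN⟩

/-- The Lie quotients are vanishing, hence discrete, so every co-Lie subgroup is open. -/
theorem IsProP.nonarchimedeanAddGroup [IsTopologicalAddGroup G] {p : ℕ} (hp : 1 ≤ p)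
    (h : IsProP G p) : NonarchimedeanAddGroup G := by
  rw [isProP_iff] at h
  refine ⟨fun U hU => ?_⟩
  obtain ⟨N, ⟨-, hN⟩, hNU⟩ := h.1 U hU
  have := hN.discreteTopology hp (isVanishing_quotient h.2 N)
  exact ⟨⟨N, QuotientAddGroup.discreteTopology_iff.1 this⟩, hNU⟩

theorem nonarchimedeanAddGroup_of_isInducing {G H : Type*} [AddCommGroup G] [TopologicalSpace G]
    [IsTopologicalAddGroup G] [AddCommGroup H] [TopologicalSpace H] [NonarchimedeanAddGroup H]
    (f : G →+ H) (hf : IsInducing f) : NonarchimedeanAddGroup G := by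
  refine ⟨fun U hU => ?_⟩
  rw [hf.nhds_eq_comap, map_zero] at hU
  obtain ⟨V, hV, hVU⟩ := hU
  obtain ⟨N, hN⟩ := NonarchimedeanAddGroup.is_nonarchimedean V hV
  exact ⟨N.comap f hf.continuous, (Set.preimage_mono hN).trans hVU⟩

theorem nonarchimedeanAddGroup_of_isOpenMap {G H : Type*} [AddCommGroup G] [TopologicalSpace G]
    [NonarchimedeanAddGroup G] [AddCommGroup H] [TopologicalSpace H] [IsTopologicalAddGroup H]
    (f : G →+ H) (hc : Continuous f) (hf : IsOpenMap f) : NonarchimedeanAddGroup H := by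
  refine ⟨fun U hU => ?_⟩
  obtain ⟨N, hN⟩ := NonarchimedeanAddGroup.is_nonarchimedean (f ⁻¹' U)
    (hc.continuousAt.preimage_mem_nhds (by rwa [map_zero]))
  exact ⟨⟨N.toAddSubgroup.map f, hf _ N.isOpen⟩, Set.image_subset_iff.2 hN⟩

instance nonarchimedeanAddGroup_pi {ι : Type*} {G : ι → Type*} [∀ i, AddCommGroup (G i)]
    [∀ i, TopologicalSpace (G i)] [∀ i, NonarchimedeanAddGroup (G i)] :
    NonarchimedeanAddGroup (∀ i, G i) := by
  refine ⟨fun U hU => ?_⟩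
  rw [nhds_pi, Filter.mem_pi] at hU
  obtain ⟨I, hI, t, ht, htU⟩ := hU
  choose N hN using fun i => NonarchimedeanAddGroup.is_nonarchimedean (t i) (ht i)
  refine ⟨⟨AddSubgroup.pi I fun i => (N i).toAddSubgroup, ?_⟩, ?_⟩
  · exact isOpen_set_pi hI fun i _ => (N i).isOpen
  · exact (Set.pi_mono fun i _ => hN i).trans htU

instance nonarchimedeanAddGroup_of_discreteTopology {G : Type*} [AddCommGroup G]
    [TopologicalSpace G] [DiscreteTopology G] : NonarchimedeanAddGroup G :=
  ⟨fun U hU => ⟨⟨⊥, isOpen_discrete _⟩, by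
    rintro x (rfl : x = 0)
    exact mem_of_mem_nhds hU⟩⟩

theorem isVanishing_pi {ι : Type} {G : ι → Type} [∀ i, AddCommGroup (G i)]
    [∀ i, TopologicalSpace (G i)] {p : ℕ} (h : ∀ i, IsVanishing (G i) p) :
    IsVanishing (∀ i, G i) p := fun x => tendsto_pi_nhds.2 fun i => h i (x i)

theorem isVanishing_iff_of_discrete [DiscreteTopology G] {p : ℕ} :
    IsVanishing G p ↔ ∀ x : G, ∃ n : ℕ, p ^ n • x = 0 := by
  refine forall_congr' fun x => ?_
  rw [nhds_discrete, tendsto_pure]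
  refine ⟨fun h => h.exists, fun ⟨n, hn⟩ => ?_⟩
  filter_upwards [eventually_ge_atTop n] with k hk
  obtain ⟨k, rfl⟩ := Nat.exists_eq_add_of_le hk
  rw [pow_add, mul_comm, mul_smul, hn, smul_zero]

end Groups

end ProP

/-! ### Kernels, cokernels and the quasi-abelian structure -/

namespace ProP

namespace PAb

variable {p : ℕ}

@[simp]
theorem id_apply (A : PAb p) (x : A) : (𝟙 A : A ⟶ A) x = x := rfl

@[simp]
theorem comp_apply {A B D : PAb p} (f : A ⟶ B) (g : B ⟶ D) (x : A) : (f ≫ g) x = g (f x) := rfl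

@[simp]
theorem zero_apply {A B : PAb p} (x : A) : (0 : A ⟶ B) x = 0 := rfl

@[simp]
theorem add_apply {A B : PAb p} (f g : A ⟶ B) (x : A) : (f + g) x = f x + g x := rfl

theorem hom_ext {A B : PAb p} {f g : A ⟶ B} (h : ∀ x, f x = g x) : f = g :=
  ContinuousAddMonoidHom.ext h

theorem map_add' {A B : PAb p} (f : A ⟶ B) (x y : A) : f (x + y) = f x + f y :=
  map_add (show A →ₜ+ B from f) x y

theorem map_zero' {A B : PAb p} (f : A ⟶ B) : f 0 = 0 :=
  map_zero (show A →ₜ+ B from f)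

theorem map_neg' {A B : PAb p} (f : A ⟶ B) (x : A) : f (-x) = -f x :=
  map_neg (show A →ₜ+ B from f) x

theorem map_sub' {A B : PAb p} (f : A ⟶ B) (x y : A) : f (x - y) = f x - f y :=
  map_sub (show A →ₜ+ B from f) x y

theorem continuous_hom {A B : PAb p} (f : A ⟶ B) : Continuous f :=
  (show A →ₜ+ B from f).continuous_toFun

/-- The underlying group homomorphism. -/
def toAddHom {A B : PAb p} (f : A ⟶ B) : A →+ B := (show A →ₜ+ B from f).toAddMonoidHom

theorem congr_hom {A B : PAb p} {f g : A ⟶ B} (h : f = g) (x : A) : f x = g x := by rw [h]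

/-- Continuous homomorphisms as morphisms. -/
def homMk {A B : PAb p} (f : A →+ B) (hf : Continuous f) : A ⟶ B :=
  (⟨f, hf⟩ : A →ₜ+ B)

/-- The object given by a vanishing nonarchimedean Polish group. -/
abbrev of (G : Type) [AddCommGroup G] [TopologicalSpace G] [NonarchimedeanAddGroup G]
    [PolishSpace G] (h : IsVanishing G p) : PAb p :=
  ⟨G, isProP_of_nonarchimedean h⟩

theorem isVanishing (A : PAb p) : IsVanishing A p := (isProP_iff.1 A.isProP).2

theorem isInducing_of_nhds_zero {A B : PAb p} (f : A ⟶ B)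
    (h : ∀ U ∈ 𝓝 (0 : A), ∃ V ∈ 𝓝 (0 : B), f ⁻¹' V ⊆ U) : IsInducing f := by
  refine (IsTopologicalAddGroup.isInducing_iff_nhds_zero (f := toAddHom f)).2 ?_
  refine le_antisymm ?_ fun U hU => ?_
  · exact ((continuous_hom f).tendsto' 0 0 (map_zero' f)).le_comap
  · exact h U hU

theorem isClosedEmbedding_of_isInducing {A B : PAb p} (f : A ⟶ B) (hf : IsInducing f) :
    IsClosedEmbedding f :=
  PolishAddGroup.isClosedEmbedding_of_isInducing (toAddHom f) hf

/-- Lifting along an embedding. -/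
theorem exists_lift {A B T : PAb p} (f : A ⟶ B) (hf : IsClosedEmbedding f) (s : T ⟶ B)
    (hs : Set.range s ⊆ Set.range f) : ∃ l : T ⟶ A, l ≫ f = s := by
  choose l hl using fun t => hs ⟨t, rfl⟩
  refine ⟨homMk ⟨⟨l, hf.injective ?_⟩, fun x y => hf.injective ?_⟩ ?_, hom_ext fun x => hl x⟩
  · rw [hl, map_zero', map_zero']
  · change f (l (x + y)) = f (l x + l y)
    rw [hl, map_add', map_add', hl, hl]
  · refine hf.isInducing.continuous_iff.2 ?_
    have : f ∘ l = s := funext hl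
    change Continuous (f ∘ l)
    rw [this]
    exact continuous_hom s

theorem mono_of_injective {A B : PAb p} (f : A ⟶ B) (hf : Function.Injective f) : Mono f :=
  ⟨fun _ _ h => hom_ext fun x => hf (congr_hom h x)⟩

theorem epi_of_surjective {A B : PAb p} (f : A ⟶ B) (hf : Function.Surjective f) : Epi f :=
  ⟨fun _ _ h => hom_ext fun x => by
    obtain ⟨x, rfl⟩ := hf x
    exact congr_hom h x⟩

theorem isClosed_ker {A B : PAb p} (f : A ⟶ B) : IsClosed ((toAddHom f).ker : Set A) :=
  isClosed_singleton.preimage (continuous_hom f)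

theorem isKernelMap_of_admissibleMono {A B : PAb p} {f : A ⟶ B} (h : QuasiAb.AdmissibleMono f) :
    QuasiAb.IsKernelMap f := by
  obtain ⟨D, g, w, hl, -⟩ := h
  exact ⟨D, g, w, hl⟩

variable [hp : Fact p.Prime]

instance (A : PAb p) : NonarchimedeanAddGroup A :=
  A.isProP.nonarchimedeanAddGroup hp.out.one_le

theorem isOpenMap_of_surjective {A B : PAb p} (f : A ⟶ B) (hf : Function.Surjective f) :
    IsOpenMap f :=
  PolishAddGroup.isOpenMap_of_surjective (toAddHom f) (continuous_hom f) hf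

/-- A closed subgroup, as an object. -/
def sub {A : PAb p} (N : AddSubgroup A) (hN : IsClosed (N : Set A)) : PAb p :=
  haveI : NonarchimedeanAddGroup N :=
    nonarchimedeanAddGroup_of_isInducing N.subtype IsInducing.subtypeVal
  haveI : PolishSpace N := hN.polishSpace
  of N (A.isVanishing.of_isInducing N.subtype IsInducing.subtypeVal)

/-- The inclusion of a closed subgroup. -/
def subι {A : PAb p} (N : AddSubgroup A) (hN : IsClosed (N : Set A)) : sub N hN ⟶ A :=
  homMk (A := sub N hN) N.subtype continuous_subtype_val

theorem isClosedEmbedding_subι {A : PAb p} (N : AddSubgroup A) (hN : IsClosed (N : Set A)) :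
    IsClosedEmbedding (subι N hN) := hN.isClosedEmbedding_subtypeVal

theorem range_subι {A : PAb p} (N : AddSubgroup A) (hN : IsClosed (N : Set A)) :
    Set.range (subι N hN) = N := Subtype.range_coe

/-- The quotient by a closed subgroup, as an object. -/
def quot {A : PAb p} (N : AddSubgroup A) (hN : IsClosed (N : Set A)) : PAb p :=
  haveI : NonarchimedeanAddGroup (A ⧸ N) := nonarchimedeanAddGroup_of_isOpenMap
    (QuotientAddGroup.mk' N) continuous_quotient_mk' QuotientAddGroup.isOpenMap_coe
  haveI : PolishSpace (A ⧸ N) := PolishAddGroup.polishSpace_quotient N hN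
  of (A ⧸ N) (isVanishing_quotient A.isVanishing N)

/-- The projection to a quotient. -/
def quotπ {A : PAb p} (N : AddSubgroup A) (hN : IsClosed (N : Set A)) : A ⟶ quot N hN :=
  homMk (B := quot N hN) (QuotientAddGroup.mk' N) continuous_quotient_mk'

theorem quotπ_surjective {A : PAb p} (N : AddSubgroup A) (hN : IsClosed (N : Set A)) :
    Function.Surjective (quotπ N hN) := QuotientAddGroup.mk_surjective

theorem quotπ_eq_zero_iff {A : PAb p} (N : AddSubgroup A) (hN : IsClosed (N : Set A)) (x : A) :
    quotπ N hN x = 0 ↔ x ∈ N := QuotientAddGroup.eq_zero_iff x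

/-- Descending along a surjection. -/
theorem exists_desc {A B T : PAb p} (g : A ⟶ B) (hg : Function.Surjective g) (s : A ⟶ T)
    (hs : ∀ x, g x = 0 → s x = 0) : ∃ d : B ⟶ T, g ≫ d = s := by
  choose r hr using hg
  have key : ∀ x, s (r (g x)) = s x := by
    intro x
    have := hs (r (g x) - x) (by rw [map_sub', hr, sub_self])
    rwa [map_sub', sub_eq_zero] at this
  -- By the open mapping theorem `g` is a topological quotient map, which is what makes the
  -- descended homomorphism continuous.
  have hq := (isOpenMap_of_surjective g fun y => ⟨r y, hr y⟩).isQuotientMap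
    (continuous_hom g) fun y => ⟨r y, hr y⟩
  refine ⟨homMk ⟨⟨fun y => s (r y), ?_⟩, fun x y => ?_⟩ ?_, hom_ext fun x => key x⟩
  · exact hs _ (hr 0)
  · change s (r (x + y)) = s (r x) + s (r y)
    rw [← map_add', ← key (r x + r y), map_add' g, hr, hr]
  · refine hq.continuous_iff.2 ?_
    have : (fun y => s (r y)) ∘ g = s := funext key
    change Continuous ((fun y => s (r y)) ∘ g)
    rw [this]
    exact continuous_hom s

theorem nonempty_isLimit_kernelFork {A B D : PAb p} (f : A ⟶ B) (g : B ⟶ D) (w : f ≫ g = 0)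
    (hf : IsClosedEmbedding f) (h : ∀ y, g y = 0 → ∃ x, f x = y) :
    Nonempty (IsLimit (KernelFork.ofι f w)) := by
  have := mono_of_injective f hf.injective
  have hl : ∀ {T : PAb p} (s : T ⟶ B), s ≫ g = 0 → ∃ l : T ⟶ A, l ≫ f = s := fun s hs =>
    exists_lift f hf s (by
      rintro _ ⟨t, rfl⟩
      exact h _ (congr_hom hs t))
  choose l hl using @hl
  exact ⟨KernelFork.IsLimit.ofι' f w fun s hs => ⟨l s hs, hl s hs⟩⟩

/-- It is enough to control the closure of the range, because the zero set of a morphism is closed.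
-/
theorem nonempty_isColimit_cokernelCofork {A B D : PAb p} (f : A ⟶ B) (g : B ⟶ D)
    (w : f ≫ g = 0) (hg : Function.Surjective g)
    (h : ∀ y, g y = 0 → y ∈ closure (Set.range f)) :
    Nonempty (IsColimit (CokernelCofork.ofπ g w)) := by
  have := epi_of_surjective g hg
  have hl : ∀ {T : PAb p} (s : B ⟶ T), f ≫ s = 0 → ∃ l : D ⟶ T, g ≫ l = s := fun s hs =>
    exists_desc g hg s (fun y hy => by
      have hc : IsClosed {y | s y = 0} := isClosed_eq (continuous_hom s) continuous_const
      refine closure_minimal ?_ hc (h y hy)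
      rintro _ ⟨t, rfl⟩
      exact congr_hom hs t)
  choose l hl using @hl
  exact ⟨CokernelCofork.IsColimit.ofπ' g w fun s hs => ⟨l s hs, hl s hs⟩⟩

theorem isKernelCokernelPair {A B D : PAb p} (f : A ⟶ B) (g : B ⟶ D)
    (hf : IsClosedEmbedding f) (hg : Function.Surjective g)
    (h : ∀ y, g y = 0 ↔ ∃ x, f x = y) : QuasiAb.IsKernelCokernelPair f g :=
  ⟨hom_ext fun x => (h _).2 ⟨x, rfl⟩,
    nonempty_isLimit_kernelFork f g _ hf fun y => (h y).1,
    nonempty_isColimit_cokernelCofork f g _ hg fun y hy => subset_closure ((h y).1 hy)⟩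

/-- Comparison with the concrete kernel `ι` gives `f = ι ∘ k`, where `k` has the continuous left
inverse `l`; so `f` is inducing. -/
theorem isClosedEmbedding_of_isKernelMap {A B : PAb p} {f : A ⟶ B} (h : QuasiAb.IsKernelMap f) :
    IsClosedEmbedding f := by
  obtain ⟨D, g, w, ⟨hl⟩⟩ := h
  let ι := subι _ (isClosed_ker g)
  have hι : ι ≫ g = 0 := hom_ext fun x => x.2
  obtain ⟨l, hl'⟩ := KernelFork.IsLimit.lift' hl ι hι
  have hl'' : l ≫ f = ι := hl'
  obtain ⟨k, hk⟩ := exists_lift ι (isClosedEmbedding_subι _ _) f (by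
    rw [range_subι]
    rintro _ ⟨x, rfl⟩
    exact congr_hom w x)
  have hkl : k ≫ l = 𝟙 A := Fork.IsLimit.hom_ext hl (by
    change (k ≫ l) ≫ f = 𝟙 A ≫ f
    rw [Category.assoc, hl'', hk, Category.id_comp])
  refine isClosedEmbedding_of_isInducing f ?_
  have : (f : A → B) = ι ∘ k := by rw [← hk]; rfl
  rw [this]
  exact (isClosedEmbedding_subι _ _).isInducing.comp
    (Function.LeftInverse.isEmbedding (f := l) (fun x => congr_hom hkl x) (continuous_hom l)
      (continuous_hom k)).isInducing

theorem admissibleMono_of_isClosedEmbedding {A B : PAb p} {f : A ⟶ B} (h : IsClosedEmbedding f) :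
    QuasiAb.AdmissibleMono f := by
  have hc : IsClosed ((toAddHom f).range : Set B) := by
    rw [AddMonoidHom.coe_range]
    exact h.isClosed_range
  exact ⟨_, quotπ _ hc, isKernelCokernelPair f _ h (quotπ_surjective _ _) fun y =>
    quotπ_eq_zero_iff _ _ y⟩

theorem isKernelMap_iff {A B : PAb p} {f : A ⟶ B} :
    QuasiAb.IsKernelMap f ↔ IsClosedEmbedding f :=
  ⟨isClosedEmbedding_of_isKernelMap, fun h =>
    isKernelMap_of_admissibleMono (admissibleMono_of_isClosedEmbedding h)⟩

theorem admissibleMono_iff {A B : PAb p} {f : A ⟶ B} :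
    QuasiAb.AdmissibleMono f ↔ IsClosedEmbedding f :=
  ⟨fun h => isKernelMap_iff.1 (isKernelMap_of_admissibleMono h),
    admissibleMono_of_isClosedEmbedding⟩

/-- The cokernel, the quotient by the closure of the image. -/
abbrev coker {A B : PAb p} (f : A ⟶ B) : PAb p :=
  quot (toAddHom f).range.topologicalClosure (AddSubgroup.isClosed_topologicalClosure _)

/-- The projection to the cokernel. -/
abbrev cokerπ {A B : PAb p} (f : A ⟶ B) : B ⟶ coker f := quotπ _ _

theorem comp_cokerπ {A B : PAb p} (f : A ⟶ B) : f ≫ cokerπ f = 0 :=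
  hom_ext fun x => (quotπ_eq_zero_iff _ _ _).2 (AddSubgroup.le_topologicalClosure _ ⟨x, rfl⟩)

/-- An abstract cokernel factors as the concrete projection followed by `e`, and `e` has the right
inverse `d`. Conversely, a surjection is the cokernel of the inclusion of its kernel. -/
theorem isCokernelMap_iff {A B : PAb p} {g : A ⟶ B} :
    QuasiAb.IsCokernelMap g ↔ Function.Surjective g := by
  constructor
  · rintro ⟨D, f, w, ⟨hg⟩⟩
    obtain ⟨d, hd⟩ := CokernelCofork.IsColimit.desc' hg (cokerπ f) (comp_cokerπ f)
    have hd' : g ≫ d = cokerπ f := hd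
    obtain ⟨e, he⟩ := exists_desc (cokerπ f) (quotπ_surjective _ _) g (fun x hx => by
      rw [quotπ_eq_zero_iff] at hx
      have hc : IsClosed {y | g y = 0} := isClosed_eq (continuous_hom g) continuous_const
      refine closure_minimal ?_ hc hx
      rintro _ ⟨t, rfl⟩
      exact congr_hom w t)
    have hde : d ≫ e = 𝟙 B := Cofork.IsColimit.hom_ext hg (by
      change g ≫ d ≫ e = g ≫ 𝟙 B
      rw [← Category.assoc, hd', he, Category.comp_id])
    have : (g : A → B) = e ∘ cokerπ f := funext fun x => (congr_hom he x).symm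
    rw [this]
    exact Function.Surjective.comp (fun y => ⟨d y, congr_hom hde y⟩) (quotπ_surjective _ _)
  · intro h
    refine ⟨_, subι _ (isClosed_ker g), hom_ext fun x => x.2,
      nonempty_isColimit_cokernelCofork _ g _ h fun y hy => subset_closure ?_⟩
    exact ⟨⟨y, hy⟩, rfl⟩

instance : HasKernels (PAb p) where
  has_limit {A B} g := by
    obtain ⟨h⟩ := nonempty_isLimit_kernelFork (subι _ (isClosed_ker g)) g
      (hom_ext fun x => x.2) (isClosedEmbedding_subι _ _) fun y hy => ⟨⟨y, hy⟩, rfl⟩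
    exact ⟨⟨⟨_, h⟩⟩⟩

instance : HasCokernels (PAb p) where
  has_colimit {A B} f := by
    obtain ⟨h⟩ := nonempty_isColimit_cokernelCofork f (cokerπ f) (comp_cokerπ f)
      (quotπ_surjective _ _) fun y hy => (quotπ_eq_zero_iff _ _ _).1 hy
    exact ⟨⟨⟨_, h⟩⟩⟩

instance : HasFiniteLimits (PAb p) := by
  have : HasFiniteProducts (PAb p) := hasFiniteProducts_of_has_binary_and_terminal
  have : HasEqualizers (PAb p) := Preadditive.hasEqualizers_of_hasKernels
  exact hasFiniteLimits_of_hasEqualizers_and_finite_products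

instance : HasFiniteColimits (PAb p) := by
  have : HasFiniteCoproducts (PAb p) := hasFiniteCoproducts_of_has_binary_and_initial
  have : HasCoequalizers (PAb p) := Preadditive.hasCoequalizers_of_hasCokernels
  exact hasFiniteColimits_of_hasCoequalizers_and_finite_coproducts

/-- The concrete fibre product maps to the abstract pull-back over `B'`, and already projects onto
`B'`. -/
theorem surjective_of_isPullback {A B A' B' : PAb p} {q' : A' ⟶ B'} {f' : A' ⟶ A} {f : B' ⟶ B}
    {q : A ⟶ B} (h : IsPullback f' q' q f) (hq : Function.Surjective q) :
    Function.Surjective q' := by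
  let P := prod A B'
  let fst : P ⟶ A := ContinuousAddMonoidHom.fst A B'
  let snd : P ⟶ B' := ContinuousAddMonoidHom.snd A B'
  let ι := subι _ (isClosed_ker (fst ≫ q - snd ≫ f))
  have hι : (ι ≫ fst) ≫ q = (ι ≫ snd) ≫ f := by
    rw [← sub_eq_zero, Category.assoc, Category.assoc, ← Preadditive.comp_sub]
    exact hom_ext fun x => x.2
  intro b
  obtain ⟨a, ha⟩ := hq (f b)
  have hab : (a, b) ∈ (toAddHom (fst ≫ q - snd ≫ f)).ker := by
    change q a - f b = 0
    rw [ha, sub_self]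
  exact ⟨h.lift _ _ hι ⟨(a, b), hab⟩, congr_hom (h.lift_snd _ _ hι) ⟨(a, b), hab⟩⟩

/-- Since `i'` followed by the comparison map to the concrete push-out `(A' × B) / γ(A)` is `inl ≫
π`, it suffices that the latter is inducing. -/
theorem isClosedEmbedding_of_isPushout {A B A' B' : PAb p} {i : A ⟶ B} {f : A ⟶ A'}
    {f' : B ⟶ B'} {i' : A' ⟶ B'} (h : IsPushout i f f' i') (hi : IsClosedEmbedding i) :
    IsClosedEmbedding i' := by
  let P := prod A' B
  let inl : A' ⟶ P := ContinuousAddMonoidHom.inl A' B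
  let inr : B ⟶ P := ContinuousAddMonoidHom.inr A' B
  let fst : P ⟶ A' := ContinuousAddMonoidHom.fst A' B
  let snd : P ⟶ B := ContinuousAddMonoidHom.snd A' B
  let γ : A ⟶ P := i ≫ inr - f ≫ inl
  have hγ : ∀ a, γ a = (-f a, i a) := fun a => by
    change ((0 : A'), i a) - (f a, (0 : B)) = _
    simp
  have hγi : IsInducing γ := by
    refine IsInducing.of_comp (continuous_hom γ) (continuous_hom snd) ?_
    have : snd ∘ γ = i := funext fun a => by
      change (γ a).2 = _
      rw [hγ]
    rw [this]
    exact hi.isInducing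
  have hγc := isClosedEmbedding_of_isInducing γ hγi
  have hc : IsClosed ((toAddHom γ).range : Set P) := by
    rw [AddMonoidHom.coe_range]
    exact hγc.isClosed_range
  let π := quotπ _ hc
  have hw : i ≫ (inr ≫ π) = f ≫ (inl ≫ π) := by
    rw [← sub_eq_zero, ← Category.assoc, ← Category.assoc, ← Preadditive.sub_comp]
    exact hom_ext fun x => (quotπ_eq_zero_iff _ _ _).2 ⟨x, rfl⟩
  refine isClosedEmbedding_of_isInducing i' ?_
  refine IsInducing.of_comp (g := h.desc _ _ hw) (continuous_hom i') (continuous_hom _) ?_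
  have he : (h.desc _ _ hw) ∘ i' = inl ≫ π := funext fun x => congr_hom (h.inr_desc _ _ hw) x
  rw [he]
  have hπ : IsOpenMap π := isOpenMap_of_surjective π (quotπ_surjective _ _)
  refine isInducing_of_nhds_zero _ fun U hU => ?_
  obtain ⟨N, hN⟩ := NonarchimedeanAddGroup.is_nonarchimedean U hU
  have hfN : f ⁻¹' N ∈ 𝓝 (0 : A) :=
    (continuous_hom f).continuousAt.preimage_mem_nhds (by rw [map_zero']; exact N.mem_nhds_zero)
  rw [hi.isInducing.nhds_eq_comap, map_zero'] at hfN
  obtain ⟨V, hV, hVN⟩ := hfN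
  -- If `(x, 0)` and `(u, v)` agree modulo `γ(A)`, they differ by some `(-f a, i a)` with `i (-a) =
  -- v ∈ V`. By the choice of `V` this gives `f (-a) ∈ N`, hence `x ∈ N`.
  refine ⟨π '' ((N : Set A') ×ˢ V), ?_, ?_⟩
  · have := hπ.image_mem_nhds (prod_mem_nhds (x := (0 : A')) (y := (0 : B)) N.mem_nhds_zero hV)
    rwa [show π ((0 : A'), (0 : B)) = 0 from map_zero' π] at this
  · rintro x ⟨⟨u, v⟩, ⟨hu, hv⟩, huv⟩
    apply hN
    have h1 : π (show P from ((x : A'), (0 : B)) - (u, v)) = 0 :=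
      (map_sub' π (x, 0) (u, v)).trans (sub_eq_zero.2 huv.symm)
    obtain ⟨a, ha⟩ := (quotπ_eq_zero_iff _ _ _).1 h1
    have ha' : (-f a, i a) = (x - u, 0 - v) := (hγ a).symm.trans ha
    have h2 : -f a = x - u := congrArg Prod.fst ha'
    have h3 : i a = 0 - v := congrArg Prod.snd ha'
    have h4 : f (-a) ∈ N := hVN (show i (-a) ∈ V by
      rw [map_neg', h3]
      simpa using hv)
    rw [map_neg', h2] at h4
    simpa using N.add_mem h4 hu

variable (p) in
theorem isQuasiAbelian : QuasiAb.IsQuasiAbelian (PAb p) where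
  hasFiniteLimits := inferInstance
  hasFiniteColimits := inferInstance
  isKernelMap_of_isPushout _ _ _ _ _ _ _ _ h hi := by
    rw [isKernelMap_iff] at *
    exact isClosedEmbedding_of_isPushout h hi
  isCokernelMap_of_isPullback _ _ _ _ _ _ _ _ h hq := by
    rw [isCokernelMap_iff] at *
    exact surjective_of_isPullback h hq

end PAb

end ProP

/-! ### Divisible groups and injective objects -/

namespace ProP

/-- Divisible abelian groups, as a proposition. -/
def IsDivisible (D : Type*) [AddCommGroup D] : Prop :=
  ∀ n : ℕ, n ≠ 0 → ∀ x : D, ∃ y : D, n • y = x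

section Divisible

variable {D : Type*} [AddCommGroup D]

theorem IsDivisible.of_surjective {E : Type*} [AddCommGroup E] (h : IsDivisible D) (f : D →+ E)
    (hf : Function.Surjective f) : IsDivisible E := by
  intro n hn x
  obtain ⟨x, rfl⟩ := hf x
  obtain ⟨y, rfl⟩ := h n hn x
  exact ⟨f y, (map_nsmul f n y).symm⟩

theorem IsDivisible.finsupp {ι : Type*} (h : IsDivisible D) : IsDivisible (ι →₀ D) := by
  intro n hn x
  classical
  induction x using Finsupp.induction_linear with
  | zero => exact ⟨0, smul_zero _⟩
  | add f g hf hg =>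
    obtain ⟨a, rfl⟩ := hf
    obtain ⟨b, rfl⟩ := hg
    exact ⟨a + b, smul_add _ _ _⟩
  | single i d =>
    obtain ⟨y, rfl⟩ := h n hn d
    exact ⟨Finsupp.single i y, (Finsupp.smul_single _ _ _)⟩

theorem IsDivisible.pi {ι : Type*} {D : ι → Type*} [∀ i, AddCommGroup (D i)]
    (h : ∀ i, IsDivisible (D i)) : IsDivisible (∀ i, D i) := by
  intro n hn x
  choose y hy using fun i => h i n hn (x i)
  exact ⟨y, funext hy⟩

/-- Divisible groups are injective. -/
theorem IsDivisible.exists_extension (h : IsDivisible D) {A B : Type*} [AddCommGroup A]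
    [AddCommGroup B] (i : A →+ B) (hi : Function.Injective i) (f : A →+ D) :
    ∃ g : B →+ D, ∀ x, g (i x) = f x := by
  let : DivisibleBy D ℕ := divisibleByOfSMulRightSurj D ℕ fun {n} hn x => h n hn x
  let : DivisibleBy D ℤ := AddGroup.divisibleByIntOfDivisibleByNat D
  obtain ⟨g, hg⟩ := (Module.Baer.of_divisible D).extension_property_addMonoidHom i hi f
  exact ⟨g, fun x => DFunLike.congr_fun hg x⟩

/-- A solution `y` in `ℚ / ℤ` may have torsion prime to `p`. With `n = p ^ a * m`, multiplying `y`
by `m` removes it, and an inverse `s` of `m` modulo `p ^ (k + a)` restores the equation. -/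
theorem isDivisible_pruferSubgroup {p : ℕ} (hp : p.Prime) : IsDivisible (pruferSubgroup p) := by
  have hQ : IsDivisible (ℚ ⧸ (Int.castAddHom ℚ).range) := by
    refine IsDivisible.of_surjective (D := ℚ) ?_ (QuotientAddGroup.mk' _)
      (QuotientAddGroup.mk'_surjective _)
    intro n hn x
    refine ⟨x / n, ?_⟩
    have : (n : ℚ) ≠ 0 := by exact_mod_cast hn
    rw [nsmul_eq_mul]
    field_simp
  rintro n hn ⟨x, k, hx⟩
  obtain ⟨a, m, hm, rfl⟩ := Nat.exists_eq_pow_mul_and_not_dvd hn p hp.ne_one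
  obtain ⟨y, hy⟩ := hQ _ hn x
  have hcop : IsCoprime (m : ℤ) ((p ^ (k + a) : ℕ) : ℤ) := by
    rw [Nat.isCoprime_iff_coprime]
    exact (((Nat.Prime.coprime_iff_not_dvd hp).2 hm).pow_left _).symm
  obtain ⟨s, t, hst⟩ := hcop
  have hmy : p ^ (k + a) • m • y = 0 := by
    rw [pow_add, mul_smul, ← mul_smul (p ^ a) m y, hy, hx]
  refine ⟨⟨s • m • y, k + a, ?_⟩, Subtype.ext ?_⟩
  · rw [smul_comm, hmy, smul_zero]
  · change (p ^ a * m) • s • m • y = x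
    rw [smul_comm, smul_comm _ m y, hy]
    have hpx : (p ^ (k + a) : ℕ) • x = 0 := by
      rw [pow_add, mul_comm, mul_smul, hx, smul_zero]
    calc s • m • x = (s * (m : ℤ) + t * ((p ^ (k + a) : ℕ) : ℤ)) • x := by
          rw [add_smul, mul_smul, mul_smul, natCast_zsmul, natCast_zsmul, hpx, smul_zero, add_zero]
      _ = x := by rw [hst, one_smul]

theorem isDivisible_pruferSum {p : ℕ} (hp : p.Prime) : IsDivisible (PruferSum p) :=
  (isDivisible_pruferSubgroup hp).finsupp (ι := ℕ)

instance (p : ℕ) : Countable (PruferSum p) := by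
  have : Countable (ℚ ⧸ (Int.castAddHom ℚ).range) := QuotientAddGroup.mk_surjective.countable
  exact inferInstanceAs (Countable (ℕ →₀ pruferSubgroup p))

instance (p : ℕ) : PolishSpace (PruferSum p) := by
  have : SecondCountableTopology (PruferSum p) :=
    DiscreteTopology.secondCountableTopology_of_countable
  infer_instance

theorem isVanishing_pruferSum (p : ℕ) : IsVanishing (PruferSum p) p := by
  rw [isVanishing_iff_of_discrete]
  intro x
  change ∃ n : ℕ, p ^ n • (show ℕ →₀ pruferSubgroup p from x) = 0
  generalize (show ℕ →₀ pruferSubgroup p from x) = y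
  induction y using Finsupp.induction_linear with
  | zero => exact ⟨0, smul_zero _⟩
  | add f g hf hg =>
    obtain ⟨a, ha⟩ := hf
    obtain ⟨b, hb⟩ := hg
    exact ⟨a + b, by rw [smul_add, pow_add, mul_smul, mul_smul, hb, smul_zero, add_zero,
      ← mul_smul, mul_comm, mul_smul, ha, smul_zero]⟩
  | single i d =>
    obtain ⟨d, n, hn⟩ := d
    exact ⟨n, by
      rw [Finsupp.smul_single, Finsupp.single_eq_zero]
      exact Subtype.ext hn⟩

/-- The cyclic group of order `p` in the Prüfer group. -/
theorem exists_zmod_injective_prufer {p : ℕ} (hp : p.Prime) :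
    ∃ c : ZMod p →+ pruferSubgroup p, Function.Injective c := by
  have hp0 : (p : ℚ) ≠ 0 := by exact_mod_cast hp.ne_zero
  let q : ℚ ⧸ (Int.castAddHom ℚ).range := ((1 / p : ℚ) : ℚ ⧸ (Int.castAddHom ℚ).range)
  have hq : ∀ m : ℤ, m • q = 0 ↔ (p : ℤ) ∣ m := by
    intro m
    rw [← QuotientAddGroup.mk_zsmul, QuotientAddGroup.eq_zero_iff]
    simp only [AddMonoidHom.mem_range, Int.coe_castAddHom, zsmul_eq_mul]
    constructor
    · rintro ⟨k, hk⟩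
      refine ⟨k, ?_⟩
      field_simp at hk
      rw [mul_comm]
      exact_mod_cast hk.symm
    · rintro ⟨k, rfl⟩
      refine ⟨k, ?_⟩
      push_cast
      field_simp
  let x : pruferSubgroup p := ⟨q, 1, by
    rw [pow_one, ← natCast_zsmul, hq]⟩
  have hx : ∀ m : ℤ, m • x = 0 ↔ (p : ℤ) ∣ m := fun m => by
    rw [← hq, Subtype.ext_iff]
    rfl
  refine ⟨ZMod.lift p ⟨zmultiplesHom _ x, ?_⟩, ?_⟩
  · exact (hx _).2 dvd_rfl
  · rw [ZMod.lift_injective]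
    intro m hm
    rw [ZMod.intCast_zmod_eq_zero_iff_dvd]
    exact (hx m).1 hm

/-- Countable `p`-groups embed into `ℤ(p^∞)^(ω)`. -/
theorem exists_injective_pruferSum {p : ℕ} (hp : p.Prime) {D : Type*} [AddCommGroup D]
    [Countable D] (hD : ∀ x : D, ∃ n : ℕ, p ^ n • x = 0) :
    ∃ f : D →+ PruferSum p, Function.Injective f := by
  have := Fact.mk hp
  -- The `p`-torsion is a countable `𝔽_p`-vector space: sending each basis vector to an order-`p`
  -- element in its own Prüfer summand embeds it, and divisibility extends this to `D`.
  let S : AddSubgroup D := (nsmulAddMonoidHom (α := D) p).ker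
  have hS : ∀ x : D, x ∈ S ↔ p • x = 0 := fun x => Iff.rfl
  let : Module (ZMod p) S := AddCommGroup.zmodModule fun x => Subtype.ext x.2
  let b := Module.Basis.ofVectorSpace (ZMod p) S
  have : Countable (Module.Basis.ofVectorSpaceIndex (ZMod p) S) := inferInstance
  obtain ⟨e, he⟩ := exists_injective_nat (Module.Basis.ofVectorSpaceIndex (ZMod p) S)
  obtain ⟨c, hc⟩ := exists_zmod_injective_prufer hp
  let φ : S →+ (ℕ →₀ pruferSubgroup p) := (Finsupp.mapDomain.addMonoidHom e).comp
    ((Finsupp.mapRange.addMonoidHom c).comp b.repr.toAddMonoidHom)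
  have hφ : Function.Injective φ := (Finsupp.mapDomain_injective he).comp
    ((Finsupp.mapRange_injective c (map_zero c) hc).comp b.repr.injective)
  obtain ⟨f, hf⟩ := (isDivisible_pruferSum hp).exists_extension S.subtype
    Subtype.coe_injective φ
  refine ⟨f, (injective_iff_map_eq_zero f).2 fun x hx => ?_⟩
  by_contra hx0
  classical
  -- The socle is essential: if `p ^ n` is the order of `x ≠ 0`, then `p ^ (n - 1) • x` is a nonzero
  -- element of `S` killed by `φ`, a contradiction.
  let n := Nat.find (hD x)
  have hn : p ^ n • x = 0 := Nat.find_spec (hD x)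
  have hn0 : n ≠ 0 := by
    intro h0
    rw [h0, pow_zero, one_smul] at hn
    exact hx0 hn
  obtain ⟨k, hk⟩ := Nat.exists_eq_succ_of_ne_zero hn0
  have hkx : p ^ k • x ≠ 0 := Nat.find_min (hD x) (show k < n by omega)
  have hkS : p ^ k • x ∈ S := by
    rw [hS, ← mul_smul, ← pow_succ', ← Nat.succ_eq_add_one, ← hk, hn]
  have h1 : φ ⟨p ^ k • x, hkS⟩ = 0 := by
    refine (hf _).symm.trans ?_
    change f (p ^ k • x) = 0
    rw [map_nsmul, hx, smul_zero]
  exact hkx (congrArg Subtype.val (hφ (h1.trans (map_zero φ).symm)))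

end Divisible

namespace PAb

variable {p : ℕ} [hp : Fact p.Prime]

/-- Continuous homomorphisms into discrete divisible groups extend along closed embeddings. -/
theorem exists_extension_discrete {X Y : PAb p} (i : X ⟶ Y) (hi : IsClosedEmbedding i) {D : Type*}
    [AddCommGroup D] [TopologicalSpace D] [DiscreteTopology D] (hD : IsDivisible D) (f : X →+ D)
    (hf : Continuous f) : ∃ g : Y →+ D, Continuous g ∧ ∀ x, g (i x) = f x := by
  have hker : (f.ker : Set X) ∈ 𝓝 (0 : X) := by
    refine ((isOpen_discrete {(0 : D)}).preimage hf).mem_nhds ?_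
    exact map_zero f
  rw [hi.isInducing.nhds_eq_comap, map_zero'] at hker
  obtain ⟨V, hV, hVf⟩ := hker
  obtain ⟨N, hN⟩ := NonarchimedeanAddGroup.is_nonarchimedean V hV
  -- Since `i` is an embedding, `ker f` contains the trace `M` of an open subgroup `N` of `Y`. The
  -- problem descends to `X ⧸ M ↪ Y ⧸ N`, and continuity is free as `Y ⧸ N` is discrete.
  let M : AddSubgroup X := N.toAddSubgroup.comap (toAddHom i)
  have hM : M ≤ f.ker := fun x hx => hVf (hN hx)
  let j : X ⧸ M →+ Y ⧸ N.toAddSubgroup := QuotientAddGroup.map M N.toAddSubgroup (toAddHom i) le_rfl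
  have hj : Function.Injective j := by
    refine (injective_iff_map_eq_zero j).2 fun x hx => ?_
    obtain ⟨x, rfl⟩ := QuotientAddGroup.mk_surjective x
    exact (QuotientAddGroup.eq_zero_iff _).2 ((QuotientAddGroup.eq_zero_iff (i x)).1 hx)
  obtain ⟨g, hg⟩ := hD.exists_extension j hj (QuotientAddGroup.lift M f hM)
  have : DiscreteTopology (Y ⧸ N.toAddSubgroup) := QuotientAddGroup.discreteTopology N.isOpen
  refine ⟨g.comp (QuotientAddGroup.mk' _), ?_, fun x => hg x⟩
  exact (continuous_of_discreteTopology (f := g)).comp continuous_quotient_mk'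

/-- Countable products of discrete divisible groups are injective. -/
theorem isInjective_of_equiv_pi {B : PAb p} {ι : Type*} {D : ι → Type*} [∀ n, AddCommGroup (D n)]
    [∀ n, TopologicalSpace (D n)] [∀ n, DiscreteTopology (D n)] (hD : ∀ n, IsDivisible (D n))
    (e : B ≃ₜ+ ∀ n, D n) : QuasiAb.IsInjective B := by
  intro X Y m hm f
  rw [admissibleMono_iff] at hm
  have h := fun n => exists_extension_discrete m hm (hD n)
    ((Pi.evalAddMonoidHom D n).comp (e.toAddMonoidHom.comp (toAddHom f)))
    ((continuous_apply n).comp (e.continuous.comp (continuous_hom f)))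
  choose g hgc hg using h
  refine ⟨homMk (e.symm.toAddMonoidHom.comp (AddMonoidHom.pi g))
    (e.symm.continuous.comp (continuous_pi hgc)), hom_ext fun x => ?_⟩
  change e.symm (fun n => g n (m x)) = f x
  rw [ContinuousAddEquiv.symm_apply_eq]
  exact funext fun n => hg n x

variable (p) in
/-- The group `(ℤ(p^∞)^(ω))^ω`, as an object. -/
noncomputable def pruferPower : PAb p :=
  of (ℕ → PruferSum p) (isVanishing_pi fun _ => isVanishing_pruferSum p)

variable (p) in
/-- The identification of `pruferPower`. -/
noncomputable def pruferPowerEquiv : pruferPower p ≃ₜ+ (ℕ → PruferSum p) :=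
  ContinuousAddEquiv.refl _

variable (p) in
theorem isInjective_pruferPower : QuasiAb.IsInjective (pruferPower p) :=
  isInjective_of_equiv_pi (fun _ => isDivisible_pruferSum hp.out) (pruferPowerEquiv p)

/-- The `n`-th coordinate is an embedding of the countable `p`-group `A ⧸ U n`, so its kernel is
exactly `U n`; as the `U n` form a basis at zero, the map is inducing. -/
theorem exists_isClosedEmbedding_pruferPower (A : PAb p) :
    ∃ m : A ⟶ pruferPower p, IsClosedEmbedding m := by
  obtain ⟨U, -, hUo, -, hU⟩ := PolishAddGroup.exists_antitone_basis_addSubgroup (G := A)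
  have h : ∀ n, ∃ f : A ⧸ U n →+ PruferSum p, Function.Injective f := fun n => by
    have := PolishAddGroup.countable_quotient_of_isOpen (U n) (hUo n)
    have : DiscreteTopology (A ⧸ U n) := QuotientAddGroup.discreteTopology (hUo n)
    exact exists_injective_pruferSum hp.out
      (isVanishing_iff_of_discrete.1 (isVanishing_quotient A.isVanishing (U n)))
  choose f hf using h
  let m : A ⟶ pruferPower p := homMk (B := pruferPower p)
    (AddMonoidHom.pi fun n => (f n).comp (QuotientAddGroup.mk' (U n))) (continuous_pi fun n => by
      have : DiscreteTopology (A ⧸ U n) := QuotientAddGroup.discreteTopology (hUo n)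
      exact (continuous_of_discreteTopology (f := f n)).comp continuous_quotient_mk')
  refine ⟨m, isClosedEmbedding_of_isInducing m (isInducing_of_nhds_zero m fun V hV => ?_)⟩
  obtain ⟨n, -, hn⟩ := hU.mem_iff.1 hV
  have ho : IsOpen {z : ℕ → PruferSum p | z n = 0} :=
    (isOpen_discrete {z : PruferSum p | z = 0}).preimage
      (continuous_apply (A := fun _ : ℕ => PruferSum p) n)
  refine ⟨{z : ℕ → PruferSum p | z n = 0}, ho.mem_nhds rfl, fun x hx => hn ?_⟩
  have : f n (x : A ⧸ U n) = 0 := hx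
  rw [← map_zero (f n)] at this
  exact (QuotientAddGroup.eq_zero_iff _).1 (hf n this)

variable (p) in
theorem hasEnoughInjectives : QuasiAb.HasEnoughInjectives (PAb p) := fun A => by
  obtain ⟨m, hm⟩ := exists_isClosedEmbedding_pruferPower A
  exact ⟨_, m, isInjective_pruferPower p, admissibleMono_of_isClosedEmbedding hm⟩

/-- A group with a basis of open divisible subgroups is a product of discrete divisible groups. -/
theorem isInjective_of_basis (B : PAb p) (U : ℕ → AddSubgroup B) (hanti : Antitone U)
    (hUo : ∀ n, IsOpen (U n : Set B)) (h0 : U 0 = ⊤)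
    (hU : (𝓝 (0 : B)).HasBasis (fun _ => True) fun n => (U n : Set B))
    (hdiv : ∀ n, IsDivisible (U n)) : QuasiAb.IsInjective B := by
  let π : ∀ n, B →+ B ⧸ U n := fun n => QuotientAddGroup.mk' (U n)
  have hπ : ∀ n x, π n x = 0 ↔ x ∈ U n := fun n x => QuotientAddGroup.eq_zero_iff x
  have hdisc : ∀ n, DiscreteTopology (B ⧸ U n) := fun n =>
    QuotientAddGroup.discreteTopology (hUo n)
  let D : ℕ → Type := fun n => (U n).map (π (n + 1))
  have hD : ∀ n, IsDivisible ((U n).map (π (n + 1))) := fun n =>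
    (hdiv n).of_surjective ((π (n + 1)).addSubgroupMap (U n))
      (AddMonoidHom.addSubgroupMap_surjective _ _)
  -- The divisible subgroup `U n / U (n + 1)` is a direct summand of the discrete group `B / U (n +
  -- 1)`; `ρ n` is a retraction onto it, automatically continuous.
  choose ρ hρ using fun n => (hD n).exists_extension ((U n).map (π (n + 1))).subtype
    Subtype.coe_injective (AddMonoidHom.id _)
  let r : ∀ n, B →+ (U n).map (π (n + 1)) := fun n => (ρ n).comp (π (n + 1))
  have hr : ∀ n, ∀ x ∈ U n, (r n x : B ⧸ U (n + 1)) = π (n + 1) x := fun n x hx =>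
    congrArg Subtype.val (hρ n ⟨π (n + 1) x, x, hx, rfl⟩)
  have hr0 : ∀ n, ∀ x ∈ U (n + 1), r n x = 0 := fun n x hx => by
    change ρ n (π (n + 1) x) = 0
    rw [(hπ _ _).2 hx, map_zero]
  have hrc : ∀ n, Continuous (r n) := fun n =>
    (continuous_of_discreteTopology (f := ρ n)).comp continuous_quotient_mk'
  let R : B →+ ∀ n, (U n).map (π (n + 1)) := AddMonoidHom.pi r
  have hRc : Continuous R := continuous_pi hrc
  have hmem : ∀ n x, (∀ i < n, r i x = 0) → x ∈ U n := by
    intro n x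
    induction n with
    | zero => rw [h0]; exact fun _ => trivial
    | succ n ih =>
      intro h
      have h1 := hr n x (ih fun i hi => h i (hi.trans n.lt_succ_self))
      rw [h n n.lt_succ_self] at h1
      exact (hπ _ _).1 h1.symm
  have hRi : IsInducing R := by
    refine IsTopologicalAddGroup.isInducing_iff_nhds_zero.2 (le_antisymm ?_ fun V hV => ?_)
    · exact (hRc.tendsto' 0 0 (map_zero R)).le_comap
    · obtain ⟨n, -, hn⟩ := hU.mem_iff.1 hV
      refine ⟨Set.pi (Set.Iio n) fun _ => {0}, set_pi_mem_nhds (Set.finite_Iio n) fun i _ =>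
        (isOpen_discrete _).mem_nhds rfl, fun x hx => hn (hmem n x fun i hi => hx i hi)⟩
  have hRe := PolishAddGroup.isClosedEmbedding_of_isInducing R hRi
  have hRs : Function.Surjective R := by
    intro z
    -- An element of `U n` corrects the `n`-th coordinate without disturbing the earlier ones. So
    -- the range is dense, and it is closed, hence everything.
    have happrox : ∀ n, ∃ b : B, ∀ i < n, r i b = z i := by
      intro n
      induction n with
      | zero => exact ⟨0, fun i hi => absurd hi (Nat.not_lt_zero i)⟩
      | succ n ih =>
        obtain ⟨b, hb⟩ := ih
        obtain ⟨u, hu, huz⟩ := (z n - r n b).2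
        have hru : r n u = z n - r n b := Subtype.ext ((hr n u hu).trans huz)
        refine ⟨b + u, fun i hi => ?_⟩
        rw [map_add]
        rcases Nat.lt_succ_iff_lt_or_eq.1 hi with hi | rfl
        · rw [hb i hi, hr0 i u (hanti hi hu), add_zero]
        · rw [hru, add_sub_cancel]
    choose b hb using happrox
    change z ∈ Set.range R
    refine hRe.isClosed_range.mem_of_tendsto (b := (atTop : Filter ℕ))
      (f := fun n => R (b n)) ?_
      (Eventually.of_forall fun n => ⟨_, rfl⟩)
    refine tendsto_pi_nhds.2 fun i => tendsto_const_nhds.congr' ?_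
    filter_upwards [eventually_gt_atTop i] with n hn
    exact (hb n i hn).symm
  let e : B ≃ₜ+ ∀ n, (U n).map (π (n + 1)) :=
    { AddEquiv.ofBijective R ⟨hRe.injective, hRs⟩ with
      continuous_toFun := hRc
      continuous_invFun := (hRe.isEmbedding.toHomeomorphOfSurjective hRs).symm.continuous }
  exact isInjective_of_equiv_pi hD e

/-- An injective object is a retract of any object into which it embeds admissibly. -/
theorem exists_surjective_of_isInjective {A : PAb p} (hA : QuasiAb.IsInjective A) :
    ∃ g : pruferPower p ⟶ A, Function.Surjective g := by
  obtain ⟨m, hm⟩ := exists_isClosedEmbedding_pruferPower A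
  obtain ⟨g, hg⟩ := hA m (admissibleMono_of_isClosedEmbedding hm) (𝟙 A)
  exact ⟨g, fun x => ⟨m x, congr_hom hg x⟩⟩

/-- The subgroup of the sequences that vanish below `n`. -/
noncomputable def pruferPowerSubgroup (p n : ℕ) : AddSubgroup (ℕ → PruferSum p) :=
  AddSubgroup.pi (Set.Iio n) fun _ => ⊥

theorem isDivisible_pruferPowerSubgroup (n : ℕ) : IsDivisible (pruferPowerSubgroup p n) := by
  intro k hk x
  obtain ⟨x, hx⟩ := x
  choose y hy using fun i => isDivisible_pruferSum hp.out k hk (x i)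
  refine ⟨⟨fun i => if i < n then 0 else y i, fun i hi => if_pos hi⟩,
    Subtype.ext (funext fun i => ?_)⟩
  change k • (if i < n then 0 else y i) = x i
  split_ifs with hi
  · rw [smul_zero]
    exact (hx i hi).symm
  · exact hy i

theorem isProP_of_surjective (A : PAb p) (B : Type) [AddCommGroup B] [TopologicalSpace B]
    [IsTopologicalAddGroup B] [PolishSpace B] (π : A →ₜ+ B) (hπ : Function.Surjective π) :
    IsProP B p := by
  have := nonarchimedeanAddGroup_of_isOpenMap π.toAddMonoidHom π.continuous_toFun
    (PolishAddGroup.isOpenMap_of_surjective π.toAddMonoidHom π.continuous_toFun hπ)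
  exact isProP_of_nonarchimedean (A.isVanishing.of_surjective π.toAddMonoidHom
    π.continuous_toFun hπ)

theorem isInjective_of_surjective {A B : PAb p} (hA : QuasiAb.IsInjective A) (f : A ⟶ B)
    (hf : Function.Surjective f) : QuasiAb.IsInjective B := by
  obtain ⟨g, hg⟩ := exists_surjective_of_isInjective hA
  let q : (ℕ → PruferSum p) →+ B := toAddHom (g ≫ f)
  have hqc : Continuous q := continuous_hom (g ≫ f)
  have hqs : Function.Surjective q := hf.comp hg
  have hqo : IsOpenMap q := isOpenMap_of_surjective (g ≫ f) hqs
  -- The tail subgroups of the power are open and divisible and form a basis at zero; all three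
  -- properties pass to images under the open surjection `q`.
  refine isInjective_of_basis B (fun n => (pruferPowerSubgroup p n).map q) ?_ ?_ ?_ ?_ ?_
  · intro a b hab
    exact AddSubgroup.map_mono fun x hx i hi => hx i (lt_of_lt_of_le hi hab)
  · intro n
    exact hqo _ (isOpen_set_pi (Set.finite_Iio n) fun _ _ => isOpen_discrete _)
  · rw [show pruferPowerSubgroup p 0 = ⊤ from eq_top_iff.2 fun x _ i hi =>
      absurd hi (Nat.not_lt_zero i)]
    exact AddSubgroup.map_top_of_surjective q hqs
  · refine ⟨fun V => ⟨fun hV => ?_, fun ⟨n, _, hn⟩ => mem_of_superset ?_ hn⟩⟩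
    · have h1 : q ⁻¹' V ∈ 𝓝 0 := hqc.continuousAt.preimage_mem_nhds (by rwa [map_zero])
      rw [nhds_pi, Filter.mem_pi] at h1
      obtain ⟨I, hI, t, ht, htV⟩ := h1
      obtain ⟨n, hn⟩ := hI.bddAbove
      refine ⟨n + 1, trivial, ?_⟩
      rintro _ ⟨x, hx, rfl⟩
      refine htV fun i hi => ?_
      rw [show x i = 0 from hx i (Nat.lt_succ_of_le (hn hi))]
      exact mem_of_mem_nhds (ht i)
    · refine IsOpen.mem_nhds ?_ (AddSubgroup.zero_mem _)
      exact hqo _ (isOpen_set_pi (Set.finite_Iio n) fun _ _ => isOpen_discrete _)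
  · intro n
    exact (isDivisible_pruferPowerSubgroup n).of_surjective
      (q.addSubgroupMap (pruferPowerSubgroup p n)) (AddMonoidHom.addSubgroupMap_surjective _ _)

end PAb

end ProP

/-! ### Maps in the derived category into two-term injective complexes -/

namespace QuasiAb

universe v u

section Localization

variable {C : Type u} [Category.{v} C]

/-- If `J` is local with respect to `W`, then the morphisms to `J` in the localization at `W` are
the morphisms to `J`. -/
theorem bijective_localization_map (W : MorphismProperty C) (J : C)
    (hJ : ∀ ⦃X Y : C⦄ (s : X ⟶ Y), W s → Function.Bijective fun g : Y ⟶ J => s ≫ g) (X : C) :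
    Function.Bijective (W.Q.map : (X ⟶ J) → (W.Q.obj X ⟶ W.Q.obj J)) := by
  constructor
  · intro f g hfg
    -- Locality of `J` says that `Hom(-, J)` inverts `W`, so it factors through the localization;
    -- evaluation at `𝟙 J` recovers `f` and `g`.
    let G : C ⥤ (Type v)ᵒᵖ := (yoneda.obj J).rightOp
    have hG : W.IsInvertedBy G := fun Y Z s hs => by
      have : IsIso ((yoneda.obj J).map s.op) := (isIso_iff_bijective _).2 (hJ s hs)
      change IsIso ((yoneda.obj J).map s.op).op
      infer_instance
    have h1 : (W.Q ⋙ Localization.Construction.lift G hG).map f =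
        (W.Q ⋙ Localization.Construction.lift G hG).map g := by
      rw [Functor.comp_map, Functor.comp_map, hfg]
    rw [Localization.Construction.fac] at h1
    have h2 := congrArg (fun k => k.unop (𝟙 J)) h1
    simpa [G] using h2
  -- `P φ` says that precomposition with `φ` preserves maps to `J` coming from `C`. It is stable
  -- under composition and holds for the generators, so it holds for all `φ`.
  · let P : MorphismProperty W.Localization := fun Y X φ =>
      ∀ h : X.as.obj ⟶ J, ∃ h' : Y.as.obj ⟶ J, W.Q.map h' = φ ≫ W.Q.map h
    have hP : P.IsStableUnderComposition := ⟨fun f g hf hg h => by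
      obtain ⟨h1, e1⟩ := hg h
      obtain ⟨h2, e2⟩ := hf h1
      exact ⟨h2, by rw [e2, e1]; exact (Category.assoc _ _ _).symm⟩⟩
    have hPtop : P = ⊤ := by
      refine Localization.Construction.morphismProperty_eq_top P (fun Y Z f h => ?_)
        (fun Y Z w hw h => ?_)
      · exact ⟨f ≫ h, W.Q.map_comp f h⟩
      · obtain ⟨h', rfl⟩ := (hJ w hw).2 h
        have e : W.Q.map (w ≫ h') = (Localization.Construction.wIso w hw).hom ≫ W.Q.map h' :=
          W.Q.map_comp w h'
        exact ⟨h', ((congrArg ((Localization.Construction.wIso w hw).inv ≫ ·) e).trans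
          (Iso.inv_hom_id_assoc _ _)).symm⟩
    intro φ
    have h1 : P φ := by rw [hPtop]; trivial
    obtain ⟨f, hf⟩ := h1 (𝟙 J)
    refine ⟨f, hf.trans ?_⟩
    erw [W.Q.map_id, Category.comp_id]

end Localization

section Injective

variable {C : Type u} [Category.{v} C] [Preadditive C]

theorem IsInjective.of_iso {I J : C} (e : I ≅ J) (h : IsInjective I) : IsInjective J := by
  intro X Y m hm f
  obtain ⟨g, hg⟩ := h m hm (f ≫ e.inv)
  exact ⟨g ≫ e.hom, by rw [← Category.assoc, hg, Category.assoc, e.inv_hom_id, Category.comp_id]⟩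

theorem isInjective_of_isZero {I : C} (h : IsZero I) : IsInjective I :=
  fun _ _ _ _ _ => ⟨0, h.eq_of_tgt _ _⟩

/-- The map `g` kills the cycles in degree `j`, so it descends to the cycles in degree `k`, from
where injectivity extends it along an admissible monic. -/
theorem IsAcyclic.exists_extension {Z : CochainComplex C ℤ} (hZ : IsAcyclic Z) {i j k : ℤ}
    (hij : i + 1 = j) (hjk : j + 1 = k) {I : C} (hI : IsInjective I) (g : Z.X j ⟶ I)
    (hg : Z.d i j ≫ g = 0) : ∃ h : Z.X k ⟶ I, Z.d j k ≫ h = g := by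
  subst hij hjk
  obtain ⟨W, m, e, h⟩ := hZ
  obtain ⟨hd, we, -, ⟨hce⟩⟩ := h i
  obtain ⟨hd', w, -, ⟨hc⟩⟩ := h (i + 1)
  have hmg : m (i + 1) ≫ g = 0 := by
    refine Cofork.IsColimit.hom_ext hce ?_
    change e i ≫ m (i + 1) ≫ g = e i ≫ 0
    rw [← Category.assoc, ← hd, hg, comp_zero]
  obtain ⟨k, hk⟩ := CokernelCofork.IsColimit.desc' hc g hmg
  obtain ⟨l, hl⟩ := hI (m (i + 1 + 1)) ⟨_, _, (h (i + 1 + 1)).2⟩ k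
  exact ⟨l, by rw [hd', Category.assoc, hl]; exact hk⟩

/-- A complex of injectives that is concentrated in two adjacent degrees. -/
structure IsTwoTermInjective (J : CochainComplex C ℤ) (a : ℤ) : Prop where
  isInjective : ∀ i, IsInjective (J.X i)
  isZero : ∀ i, i ≠ a → i ≠ a + 1 → IsZero (J.X i)

theorem IsTwoTermInjective.shift {J : CochainComplex C ℤ} {a : ℤ} (h : IsTwoTermInjective J a)
    (n : ℤ) : IsTwoTermInjective (J⟦n⟧) (a - n) where
  isInjective i := h.isInjective (i + n)
  isZero i h1 h2 := h.isZero (i + n) (by omega) (by omega)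

/-- Only two components of the homotopy can be nonzero: `u` comes from extending `f.f a`, and `t`
from extending what `u` leaves of `f` in degree `a + 1`. -/
theorem IsTwoTermInjective.nonempty_homotopy {J : CochainComplex C ℤ} {a : ℤ}
    (hJ : IsTwoTermInjective J a) {Z : CochainComplex C ℤ} (hZ : IsAcyclic Z) (f : Z ⟶ J) :
    Nonempty (Homotopy f 0) := by
  obtain ⟨b, hb⟩ : ∃ b, b = a + 1 := ⟨_, rfl⟩
  obtain ⟨c, hc⟩ : ∃ c, c = b + 1 := ⟨_, rfl⟩
  obtain ⟨z, hz⟩ : ∃ z, z + 1 = a := ⟨a - 1, by omega⟩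
  have hz0 : IsZero (J.X z) := hJ.isZero z (by omega) (by omega)
  obtain ⟨u, hu⟩ := hZ.exists_extension hz hb.symm (hJ.isInjective a) (f.f a) (by
    rw [← f.comm, hz0.eq_of_tgt (f.f z) 0, zero_comp])
  obtain ⟨t, ht⟩ := hZ.exists_extension hb.symm hc.symm (hJ.isInjective b)
    (f.f b - u ≫ J.d a b) (by
      rw [Preadditive.comp_sub, ← f.comm, ← Category.assoc, hu, sub_self])
  let h0 : ∀ q : ℤ × ℤ, Z.X q.1 ⟶ J.X q.2 := fun _ => 0
  -- Indexing by pairs of degrees lets the two components be inserted without transport along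
  -- equalities of degrees.
  let h : ∀ q : ℤ × ℤ, Z.X q.1 ⟶ J.X q.2 :=
    Function.update (Function.update h0 (b, a) u) (c, b) t
  have hba : h (b, a) = u := by
    have : ((b, a) : ℤ × ℤ) ≠ (c, b) := fun h => by
      have := (Prod.ext_iff.1 h).1
      simp only at this
      omega
    simp only [h]
    rw [Function.update_of_ne this, Function.update_self]
  have hcb : h (c, b) = t := Function.update_self _ _ _
  refine ⟨{ hom := fun i j => if i = j + 1 then h (i, j) else 0
            zero := fun i j hij => if_neg fun h => hij h.symm
            comm := fun j => ?_ }⟩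
  rw [dNext_eq _ (show (ComplexShape.up ℤ).Rel j (j + 1) from rfl),
    prevD_eq _ (show (ComplexShape.up ℤ).Rel (j - 1) j from sub_add_cancel j 1),
    HomologicalComplex.zero_f, add_zero, if_pos rfl, if_pos (by omega)]
  by_cases hja : j = a
  · subst hja
    rw [(hJ.isZero (j - 1) (by omega) (by omega)).eq_of_tgt (h (j, j - 1)) 0, zero_comp, add_zero]
    subst hb
    rw [hba, hu]
  by_cases hjb : j = b
  · subst hjb
    obtain rfl : a = j - 1 := by omega
    subst hc
    rw [hcb, hba, ht, sub_add_cancel]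
  · exact (hJ.isZero j hja (by omega)).eq_of_tgt _ _

theorem hom_eq_zero_of_isAcyclic {J : CochainComplex C ℤ} {a : ℤ} (hJ : IsTwoTermInjective J a)
    {Z : CochainComplex C ℤ} (hZ : IsAcyclic Z)
    (f : (HomotopyCategory.quotient C (ComplexShape.up ℤ)).obj Z ⟶
      (HomotopyCategory.quotient C (ComplexShape.up ℤ)).obj J) : f = 0 := by
  obtain ⟨f, rfl⟩ := (HomotopyCategory.quotient C (ComplexShape.up ℤ)).map_surjective f
  obtain ⟨h⟩ := hJ.nonempty_homotopy hZ f
  rw [HomotopyCategory.eq_of_homotopy _ _ h, Functor.map_zero]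

variable [HasBinaryBiproducts C] [HasZeroObject C]

/-- In the long exact sequence of the cone triangle, injectivity follows from `Hom(cone, J) = 0` and
surjectivity from `Hom(cone[-1], J) = 0`. The latter is `Hom(cone, J[1]) = 0`, and `J[1]` is again
two-term injective. -/
theorem IsTwoTermInjective.bijective_comp {J : CochainComplex C ℤ} {a : ℤ}
    (hJ : IsTwoTermInjective J a) {K L : CochainComplex C ℤ} (φ : K ⟶ L)
    (hφ : IsAcyclic (CochainComplex.mappingCone φ)) : Function.Bijective
      fun g : (HomotopyCategory.quotient C (ComplexShape.up ℤ)).obj L ⟶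
        (HomotopyCategory.quotient C (ComplexShape.up ℤ)).obj J =>
      (HomotopyCategory.quotient C (ComplexShape.up ℤ)).map φ ≫ g := by
  have hT := HomotopyCategory.mappingCone_triangleh_distinguished φ
  constructor
  · intro f g hfg
    have hfg' : (HomotopyCategory.quotient C (ComplexShape.up ℤ)).map φ ≫ (f - g) = 0 := by
      rw [Preadditive.comp_sub]
      exact sub_eq_zero.2 hfg
    obtain ⟨k, hk⟩ := Pretriangulated.Triangle.yoneda_exact₂ _ hT (f - g) hfg'
    rw [hom_eq_zero_of_isAcyclic hJ hφ k] at hk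
    exact sub_eq_zero.1 (hk.trans comp_zero)
  · intro g
    have key : ∀ f : ((HomotopyCategory.quotient C (ComplexShape.up ℤ)).obj
        (CochainComplex.mappingCone φ))⟦(-1 : ℤ)⟧ ⟶
        (HomotopyCategory.quotient C (ComplexShape.up ℤ)).obj J, f = 0 := by
      intro f
      refine (shiftFunctor (HomotopyCategory C (ComplexShape.up ℤ)) (1 : ℤ)).map_injective ?_
      rw [Functor.map_zero]
      have h1 := hom_eq_zero_of_isAcyclic (hJ.shift 1) hφ
        ((shiftNegShift _ (1 : ℤ)).inv ≫ f⟦(1 : ℤ)⟧' ≫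
          ((HomotopyCategory.quotient C (ComplexShape.up ℤ)).commShiftIso (1 : ℤ)).inv.app J)
      exact (Preadditive.IsIso.comp_right_eq_zero _ _).1
        ((Preadditive.IsIso.comp_left_eq_zero _ _).1 h1)
    obtain ⟨k, hk⟩ := Pretriangulated.Triangle.yoneda_exact₂ _
      (Pretriangulated.inv_rot_of_distTriang _ hT) g (key _)
    exact ⟨k, hk.symm⟩

/-- Morphisms to two-term complexes of injectives in the derived category are homotopy classes of
chain maps. -/
theorem IsTwoTermInjective.bijective_map {J : CochainComplex C ℤ} {a : ℤ}
    (hJ : IsTwoTermInjective J a) (K : CochainComplex C ℤ) : Function.Bijective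
      ((quasiIsos C).Q.map : ((HomotopyCategory.quotient C (ComplexShape.up ℤ)).obj K ⟶
        (HomotopyCategory.quotient C (ComplexShape.up ℤ)).obj J) → _) := by
  refine bijective_localization_map _ _ ?_ _
  rintro X Y s ⟨φ, rfl, hφ⟩
  exact hJ.bijective_comp φ hφ

theorem isIso_toDerived_map {K L : CochainComplex C ℤ} (φ : K ⟶ L)
    (hφ : IsAcyclic (CochainComplex.mappingCone φ)) : IsIso ((toDerived C).map φ) :=
  (quasiIsos C).Q_inverts _ ⟨φ, rfl, hφ⟩

end Injective

end QuasiAb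

/-! ### Ext groups of pro-$p$ groups and the homological dimension -/

namespace ProP

namespace PAb

variable {p : ℕ} [hp : Fact p.Prime]

theorem eq_zero_of_isZero {A : PAb p} (h : IsZero A) (x : A) : x = 0 :=
  congr_hom (h.eq_of_src (𝟙 A) 0) x

/-- Exactness of a complex on the level of elements. -/
def IsExact (K : CochainComplex (PAb p) ℤ) : Prop :=
  ∀ i j k : ℤ, i + 1 = j → j + 1 = k → ∀ x : K.X j, K.d j k x = 0 → ∃ y : K.X i, K.d i j y = x

/-- With the kernels of the differentials as cycles, elementwise exactness makes the corestricted
differentials surjective, and surjections are cokernels. -/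
theorem IsExact.isAcyclic {K : CochainComplex (PAb p) ℤ} (h : IsExact K) : QuasiAb.IsAcyclic K := by
  let m : ∀ n, sub _ (isClosed_ker (K.d n (n + 1))) ⟶ K.X n := fun n => subι _ _
  have hm : ∀ n, IsClosedEmbedding (m n) := fun n => isClosedEmbedding_subι _ _
  have hmr : ∀ n x, K.d n (n + 1) x = 0 ↔ ∃ y, m n y = x := fun n x =>
    ⟨fun hx => ⟨⟨x, hx⟩, rfl⟩, by
      rintro ⟨y, rfl⟩
      exact y.2⟩
  have he : ∀ n, ∃ e, e ≫ m (n + 1) = K.d n (n + 1) := fun n =>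
    exists_lift (m (n + 1)) (hm (n + 1)) (K.d n (n + 1)) (by
      rintro _ ⟨x, rfl⟩
      exact (hmr _ _).1 (congr_hom (K.d_comp_d n (n + 1) (n + 1 + 1)) x))
  choose e he using he
  have hme : ∀ n x, m (n + 1) (e n x) = K.d n (n + 1) x := fun n x => congr_hom (he n) x
  refine ⟨_, m, e, fun n => ⟨(he n).symm, isKernelCokernelPair _ _ (hm n) ?_ fun y => ?_⟩⟩
  · intro z
    obtain ⟨y, hy⟩ := h n (n + 1) (n + 1 + 1) rfl rfl (m (n + 1) z) ((hmr _ _).2 ⟨z, rfl⟩)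
    exact ⟨y, (hm (n + 1)).injective ((hme n y).trans hy)⟩
  · rw [← hmr, ← hme]
    refine ⟨fun h0 => by rw [h0, map_zero'], fun h0 => (hm (n + 1)).injective ?_⟩
    rw [h0, map_zero']

theorem IsExact.of_iso {K L : CochainComplex (PAb p) ℤ} (h : IsExact K) (e : K ≅ L) :
    IsExact L := by
  intro i j k hij hjk x hx
  have hinv : ∀ n (y : L.X n), e.hom.f n (e.inv.f n y) = y := fun n y =>
    congr_hom (by rw [← HomologicalComplex.comp_f, e.inv_hom_id, HomologicalComplex.id_f] :
      e.inv.f n ≫ e.hom.f n = 𝟙 _) y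
  obtain ⟨y, hy⟩ := h i j k hij hjk (e.inv.f j x) (by
    have := congr_hom (e.inv.comm j k) x
    rw [comp_apply, comp_apply, hx, map_zero'] at this
    exact this)
  refine ⟨e.hom.f i y, ?_⟩
  have := congr_hom (e.hom.comm i j) y
  rw [comp_apply, comp_apply, hy, hinv] at this
  exact this

theorem IsExact.shift {K : CochainComplex (PAb p) ℤ} (h : IsExact K) (n : ℤ) :
    IsExact (K⟦n⟧) := by
  intro i j k hij hjk x hx
  have hd : ∀ a b, (K⟦n⟧).d a b = K.d (a + n) (b + n) ∨ (K⟦n⟧).d a b = -K.d (a + n) (b + n) := by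
    intro a b
    rw [CochainComplex.shiftFunctor_obj_d']
    rcases Int.units_eq_one_or n.negOnePow with h1 | h1 <;> rw [h1]
    · exact Or.inl (one_smul _ _)
    · exact Or.inr (by simp [Units.smul_def])
  have hx' : K.d (j + n) (k + n) x = 0 := by
    rcases hd j k with h1 | h1
    · rw [h1] at hx
      exact hx
    · rw [h1] at hx
      exact neg_eq_zero.1 hx
  obtain ⟨y, hy⟩ := h (i + n) (j + n) (k + n) (by omega) (by omega) x hx'
  rcases hd i j with h1 | h1
  · exact ⟨y, by rw [h1]; exact hy⟩
  · refine ⟨(-y : K.X (i + n)), ?_⟩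
    rw [h1]
    change -(K.d (i + n) (j + n) (-y)) = x
    rw [map_neg', neg_neg, hy]

/-- Criterion for the exactness of the mapping cone of a chain map out of a complex with zero
differentials. -/
theorem isExact_mappingCone {K L : CochainComplex (PAb p) ℤ} (φ : K ⟶ L)
    (hK : ∀ i j, K.d i j = 0)
    (h1 : ∀ j k : ℤ, j + 1 = k → ∀ (b : K.X k) (y : L.X j), φ.f k b + L.d j k y = 0 → b = 0)
    (h2 : ∀ i j k : ℤ, i + 1 = j → j + 1 = k → ∀ y : L.X j, L.d j k y = 0 →
      ∃ (b : K.X j) (x : L.X i), φ.f j b + L.d i j x = y) :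
    IsExact (CochainComplex.mappingCone φ) := by
  intro i j k hij hjk x hx
  have hid := congr_hom (CochainComplex.mappingCone.id_X φ j k hjk) x
  obtain ⟨b, hb⟩ : ∃ b, b = (CochainComplex.mappingCone.fst φ).1.v j k hjk x := ⟨_, rfl⟩
  obtain ⟨y, hy⟩ : ∃ y, y = (CochainComplex.mappingCone.snd φ).v j j (add_zero j) x := ⟨_, rfl⟩
  rw [add_apply, comp_apply, comp_apply, id_apply, ← hb, ← hy] at hid
  have hd := congr_hom (CochainComplex.mappingCone.d_snd_v φ j k hjk) x
  rw [comp_apply, add_apply, comp_apply, comp_apply, hx, map_zero', ← hb, ← hy] at hd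
  -- A cycle `(b, y)` of the cone satisfies `φ b + d y = 0`; so `b = 0`, and `y` is a cycle of `L`
  -- to which `h2` applies.
  have hb0 : b = 0 := h1 j k hjk b y hd.symm
  rw [hb0, map_zero', zero_add] at hid
  rw [hb0, map_zero', zero_add] at hd
  obtain ⟨b', x', hbx⟩ := h2 i j k hij hjk y hd.symm
  refine ⟨(CochainComplex.mappingCone.inl φ).v j i (by omega) b' +
    (CochainComplex.mappingCone.inr φ).f i x', ?_⟩
  have e1 := congr_hom (CochainComplex.mappingCone.inl_v_d φ j i k (by omega) (by omega)) b'
  rw [hK, zero_comp, sub_zero] at e1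
  have e2 := congr_hom (CochainComplex.mappingCone.inr_f_d φ i j) x'
  rw [comp_apply, comp_apply] at e1 e2
  rw [map_add', e1, e2, ← map_add', hbx, hid]

/-- The complex `I₀ ⟶ I₁` in degrees `0` and `1`. -/
noncomputable abbrev twoTerm {I₀ I₁ : PAb p} (g : I₀ ⟶ I₁) : CochainComplex (PAb p) ℤ :=
  HomologicalComplex.double g (show (ComplexShape.up ℤ).Rel 0 1 from rfl)

theorem isZero_twoTerm_X {I₀ I₁ : PAb p} (g : I₀ ⟶ I₁) (i : ℤ) (h₀ : i ≠ 0) (h₁ : i ≠ 1) :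
    IsZero ((twoTerm g).X i) :=
  HomologicalComplex.isZero_double_X _ _ i h₀ h₁

/-- The term of degree `0`. -/
noncomputable abbrev twoTermXIso₀ {I₀ I₁ : PAb p} (g : I₀ ⟶ I₁) : (twoTerm g).X 0 ≅ I₀ :=
  HomologicalComplex.doubleXIso₀ _ _

/-- The term of degree `1`. -/
noncomputable abbrev twoTermXIso₁ {I₀ I₁ : PAb p} (g : I₀ ⟶ I₁) : (twoTerm g).X 1 ≅ I₁ :=
  HomologicalComplex.doubleXIso₁ _ _ zero_ne_one

theorem twoTerm_d {I₀ I₁ : PAb p} (g : I₀ ⟶ I₁) :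
    (twoTerm g).d 0 1 = (twoTermXIso₀ g).hom ≫ g ≫ (twoTermXIso₁ g).inv :=
  HomologicalComplex.double_d _ _ zero_ne_one

theorem isTwoTermInjective_twoTerm {I₀ I₁ : PAb p} (g : I₀ ⟶ I₁) (h₀ : QuasiAb.IsInjective I₀)
    (h₁ : QuasiAb.IsInjective I₁) : QuasiAb.IsTwoTermInjective (twoTerm g) 0 where
  isInjective i := by
    by_cases hi0 : i = 0
    · subst hi0
      exact h₀.of_iso (twoTermXIso₀ g).symm
    by_cases hi1 : i = 1
    · subst hi1
      exact h₁.of_iso (twoTermXIso₁ g).symm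
    · exact QuasiAb.isInjective_of_isZero (isZero_twoTerm_X g i hi0 hi1)
  isZero := isZero_twoTerm_X g

/-- The augmentation of a two-term complex. -/
noncomputable def augmentation {B I₀ I₁ : PAb p} (m : B ⟶ I₀) (g : I₀ ⟶ I₁) (w : m ≫ g = 0) :
    (CochainComplex.singleFunctor (PAb p) 0).obj B ⟶ twoTerm g :=
  HomologicalComplex.mkHomFromSingle (m ≫ (twoTermXIso₀ g).inv) (by
    rintro k (rfl : (0 : ℤ) + 1 = k)
    change _ ≫ (twoTerm g).d 0 1 = 0
    rw [twoTerm_d]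
    simp [reassoc_of% w])

/-- The first condition of `isExact_mappingCone` is injectivity of `m`; the second is exactness at
`I₀` in degree `0` and surjectivity of `g` in degree `1`. -/
theorem isExact_mappingCone_augmentation {B I₀ I₁ : PAb p} (m : B ⟶ I₀) (g : I₀ ⟶ I₁)
    (w : m ≫ g = 0) (hm : Function.Injective m) (hg : Function.Surjective g)
    (hmg : ∀ y, g y = 0 → ∃ x, m x = y) :
    IsExact (CochainComplex.mappingCone (augmentation m g w)) := by
  have hz : ∀ i : ℤ, i ≠ 0 → i ≠ 1 → ∀ y : (twoTerm g).X i, y = 0 := fun i h0 h1 =>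
    eq_zero_of_isZero (isZero_twoTerm_X g i h0 h1)
  let α : ((CochainComplex.singleFunctor (PAb p) 0).obj B).X 0 ≅ B :=
    HomologicalComplex.singleObjXSelf (ComplexShape.up ℤ) 0 B
  let β₀ := twoTermXIso₀ g
  let β₁ := twoTermXIso₁ g
  have hinj : ∀ {X Y : PAb p} (e : X ≅ Y), Function.Injective e.hom := fun e =>
    Function.LeftInverse.injective (g := e.inv) (congr_hom e.hom_inv_id)
  have hsurj : ∀ {X Y : PAb p} (e : X ≅ Y), Function.Surjective e.hom := fun e =>
    Function.RightInverse.surjective (g := e.inv) (congr_hom e.inv_hom_id)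
  have hφ : (augmentation m g w).f 0 = α.hom ≫ m ≫ β₀.inv :=
    HomologicalComplex.mkHomFromSingle_f _ _
  have hφ' : ∀ b, (augmentation m g w).f 0 b = β₀.inv (m (α.hom b)) := congr_hom hφ
  have hd : ∀ y, (twoTerm g).d 0 1 y = β₁.inv (g (β₀.hom y)) :=
    congr_hom (twoTerm_d g)
  refine isExact_mappingCone _ (fun i j => HomologicalComplex.single_obj_d _ _ _ _ _) ?_ ?_
  · intro j k hjk b y h
    by_cases hk : k = 0
    · subst hk
      rw [hz j (by omega) (by omega) y, map_zero', add_zero, hφ'] at h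
      refine hinj α (hm (hinj β₀.symm ?_))
      rw [map_zero' α.hom, map_zero' m]
      exact h.trans (map_zero' _).symm
    · exact eq_zero_of_isZero (HomologicalComplex.isZero_single_obj_X _ _ _ k hk) b
  · intro i j k hij hjk y hy
    by_cases hj0 : j = 0
    · subst hj0
      obtain rfl : k = 1 := by omega
      rw [hd] at hy
      have h1 : g (β₀.hom y) = 0 := hinj β₁.symm (hy.trans (map_zero' _).symm)
      obtain ⟨x, hx⟩ := hmg _ h1
      obtain ⟨b, rfl⟩ := hsurj α x
      refine ⟨b, 0, ?_⟩
      rw [map_zero', add_zero, hφ', hx]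
      exact congr_hom β₀.hom_inv_id y
    by_cases hj1 : j = 1
    · subst hj1
      obtain rfl : i = 0 := by omega
      obtain ⟨z, hz⟩ := hg (β₁.hom y)
      obtain ⟨x, rfl⟩ := hsurj β₀ z
      refine ⟨0, x, ?_⟩
      rw [map_zero', zero_add, hd, hz]
      exact congr_hom β₁.hom_inv_id y
    · exact ⟨0, 0, by rw [map_zero', map_zero', add_zero, hz j hj0 hj1 y]⟩

/-- Each object has an injective resolution of length one. -/
theorem exists_injective_resolution (B : PAb p) : ∃ (I₁ : PAb p) (m : B ⟶ pruferPower p)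
    (g : pruferPower p ⟶ I₁), QuasiAb.IsInjective I₁ ∧ IsClosedEmbedding m ∧
      Function.Surjective g ∧ ∀ y, g y = 0 ↔ ∃ x, m x = y := by
  obtain ⟨m, hm⟩ := exists_isClosedEmbedding_pruferPower B
  have hc : IsClosed ((toAddHom m).range : Set (pruferPower p)) := by
    rw [AddMonoidHom.coe_range]
    exact hm.isClosed_range
  exact ⟨_, m, quotπ _ hc, isInjective_of_surjective (isInjective_pruferPower p) _
    (quotπ_surjective _ _), hm, quotπ_surjective _ _, fun y => quotπ_eq_zero_iff _ _ y⟩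

/-- Ext groups in terms of injective resolutions of length one. -/
theorem nonempty_ext_equiv {B I₀ I₁ : PAb p} (m : B ⟶ I₀) (g : I₀ ⟶ I₁)
    (h₀ : QuasiAb.IsInjective I₀) (h₁ : QuasiAb.IsInjective I₁) (hm : Function.Injective m)
    (hg : Function.Surjective g) (hmg : ∀ y, g y = 0 ↔ ∃ x, m x = y) (A : PAb p) (n : ℤ) :
    Nonempty (QuasiAb.Ext A B n ≃
      ((HomotopyCategory.quotient (PAb p) (ComplexShape.up ℤ)).obj
        ((CochainComplex.singleFunctor (PAb p) 0).obj A) ⟶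
      (HomotopyCategory.quotient (PAb p) (ComplexShape.up ℤ)).obj ((twoTerm g)⟦n⟧))) := by
  have w : m ≫ g = 0 := hom_ext fun x => (hmg _).2 ⟨x, rfl⟩
  have hex := isExact_mappingCone_augmentation m g w hm hg fun y => (hmg y).1
  -- The cone of the shifted augmentation is isomorphic to the shifted cone, so the augmentation
  -- stays a quasi-isomorphism after shifting by `n`.
  have hac := ((hex.shift n).of_iso
    (CochainComplex.mappingCone.shiftIso (augmentation m g w) n)).isAcyclic
  have := QuasiAb.isIso_toDerived_map _ hac
  have hb := ((isTwoTermInjective_twoTerm g h₀ h₁).shift n).bijective_map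
    ((CochainComplex.singleFunctor (PAb p) 0).obj A)
  exact ⟨(Iso.homToEquiv (asIso ((QuasiAb.toDerived (PAb p)).map
    ((augmentation m g w)⟦n⟧')))).trans (Equiv.ofBijective _ hb).symm⟩

/-- `A` sits in degree `0`, where the shifted resolution has its `n`-th term, which is zero for `n >
1`. -/
theorem subsingleton_ext (A B : PAb p) (n : ℤ) (hn : 1 < n) :
    Subsingleton (QuasiAb.Ext A B n) := by
  obtain ⟨I₁, m, g, h₁, hm, hg, hmg⟩ := exists_injective_resolution B
  obtain ⟨e⟩ := nonempty_ext_equiv m g (isInjective_pruferPower p) h₁ hm.injective hg hmg A n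
  refine e.subsingleton_congr.2 ⟨fun f f' => ?_⟩
  obtain ⟨f, rfl⟩ := (HomotopyCategory.quotient _ _).map_surjective f
  obtain ⟨f', rfl⟩ := (HomotopyCategory.quotient _ _).map_surjective f'
  congr 1
  ext i
  by_cases hi : i = 0
  · subst hi
    have hz : IsZero (((twoTerm g)⟦n⟧).X 0) :=
      isZero_twoTerm_X g (0 + n) (by omega) (by omega)
    exact congr_hom (hz.eq_of_tgt _ _) _
  · exact congr_hom ((HomologicalComplex.isZero_single_obj_X _ _ _ i hi).eq_of_src _ _) _

theorem exists_section_of_comp_eq {I₀ I₁ S T V : PAb p} (g : I₀ ⟶ I₁) (γ : S ≅ I₁) (β₀ : T ≅ I₀)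
    (β₁ : V ≅ I₁) (k : S ⟶ T) (h : γ.hom ≫ β₁.inv = k ≫ (-(β₀.hom ≫ g ≫ β₁.inv))) :
    ∃ s : I₁ ⟶ I₀, s ≫ g = 𝟙 I₁ := by
  refine ⟨-(γ.inv ≫ k ≫ β₀.hom), ?_⟩
  rw [← cancel_mono β₁.inv, ← cancel_epi γ.hom, Category.id_comp, h]
  simp

/-- If `Ext¹(I₁, B)` vanishes, then the injective resolution `B ⟶ I₀ ⟶ I₁` splits. -/
theorem exists_section_of_subsingleton_ext {B I₀ I₁ : PAb p} (m : B ⟶ I₀) (g : I₀ ⟶ I₁)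
    (h₀ : QuasiAb.IsInjective I₀) (h₁ : QuasiAb.IsInjective I₁) (hm : Function.Injective m)
    (hg : Function.Surjective g) (hmg : ∀ y, g y = 0 ↔ ∃ x, m x = y)
    (h : Subsingleton (QuasiAb.Ext I₁ B 1)) : ∃ s : I₁ ⟶ I₀, s ≫ g = 𝟙 I₁ := by
  obtain ⟨e⟩ := nonempty_ext_equiv m g h₀ h₁ hm hg hmg I₁ 1
  have hs := e.subsingleton_congr.1 h
  let β₀ := twoTermXIso₀ g
  let β₁ := twoTermXIso₁ g
  -- The identity of `I₁`, viewed as a chain map to the shifted resolution, represents the class of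
  -- the extension. A null-homotopy has one relevant component, `I₁ ⟶ I₀`, which is minus a section
  -- because the shift negates the differential.
  let ι : I₁ ⟶ ((twoTerm g)⟦(1 : ℤ)⟧).X 0 := β₁.inv
  have hι : ∀ k, (ComplexShape.up ℤ).Rel 0 k → ι ≫ ((twoTerm g)⟦(1 : ℤ)⟧).d 0 k = 0 := by
    rintro k (rfl : (0 : ℤ) + 1 = k)
    have hz : IsZero (((twoTerm g)⟦(1 : ℤ)⟧).X (0 + 1)) :=
      isZero_twoTerm_X g (0 + 1 + 1) (by omega) (by omega)
    exact hz.eq_of_tgt _ _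
  let α : (CochainComplex.singleFunctor (PAb p) 0).obj I₁ ⟶ (twoTerm g)⟦(1 : ℤ)⟧ :=
    HomologicalComplex.mkHomFromSingle ι hι
  let γ := (HomologicalComplex.singleObjXSelf (ComplexShape.up ℤ) 0 I₁)
  have hα : α.f 0 = γ.hom ≫ ι := HomologicalComplex.mkHomFromSingle_f _ _
  have hα0 : (HomotopyCategory.quotient _ _).map α = (HomotopyCategory.quotient _ _).map 0 :=
    Subsingleton.elim _ _
  have H := HomotopyCategory.homotopyOfEq _ _ hα0
  have hc := H.comm 0
  rw [dNext_eq _ (show (ComplexShape.up ℤ).Rel 0 1 from rfl),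
    prevD_eq _ (show (ComplexShape.up ℤ).Rel (-1) 0 from rfl), CochainComplex.singleFunctor_obj_d,
    zero_comp, zero_add, HomologicalComplex.zero_f, add_zero, hα] at hc
  have hd : ((twoTerm g)⟦(1 : ℤ)⟧).d (-1) 0 = -(β₀.hom ≫ g ≫ β₁.inv) := by
    rw [CochainComplex.shiftFunctor_obj_d', ← twoTerm_d, Int.negOnePow_one]
    exact (neg_one_smul ℤ _)
  rw [hd] at hc
  exact exists_section_of_comp_eq g γ β₀ β₁ _ hc

/-- The cyclic group of order `p`, as an object. -/
theorem exists_not_isDivisible (p : ℕ) [hp : Fact p.Prime] : ∃ B : PAb p, ¬ IsDivisible B := by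
  have hsmul : ∀ x : ZMod p, p • x = 0 := fun x => by simp
  refine ⟨of (ZMod p) (isVanishing_iff_of_discrete.2 fun x => ⟨1, by rw [pow_one, hsmul]⟩),
    fun h => ?_⟩
  obtain ⟨y, hy⟩ := h p hp.out.ne_zero (1 : ZMod p)
  rw [hsmul y] at hy
  exact zero_ne_one hy

-- Take `B` not divisible. A splitting of its resolution would make `B` a retract of the divisible
-- group `pruferPower p`.
variable (p) in
theorem exists_not_subsingleton_ext : ∃ A B : PAb p, ¬ Subsingleton (QuasiAb.Ext A B 1) := by
  obtain ⟨B, hB⟩ := exists_not_isDivisible p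
  obtain ⟨I₁, m, g, h₁, hm, hg, hmg⟩ := exists_injective_resolution B
  refine ⟨I₁, B, fun h => hB ?_⟩
  obtain ⟨s, hs⟩ := exists_section_of_subsingleton_ext m g (isInjective_pruferPower p) h₁
    hm.injective hg hmg h
  -- The idempotent `1 - g ≫ s` lands in `ker g`, the image of `m`, and so lifts to a retraction of
  -- `m`.
  obtain ⟨r, hr⟩ := exists_lift m hm (𝟙 _ - g ≫ s) (by
    rintro _ ⟨x, rfl⟩
    refine (hmg _).1 ?_
    rw [← comp_apply, Preadditive.sub_comp, Category.assoc, hs, Category.id_comp, Category.comp_id,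
      sub_self, zero_apply])
  have hI : IsDivisible (pruferPower p) := IsDivisible.pi fun _ : ℕ => isDivisible_pruferSum hp.out
  refine hI.of_surjective (toAddHom r) fun b => ⟨m b, hm.injective ?_⟩
  have h1 : m (r (m b)) = m b - s (g (m b)) := congr_hom hr (m b)
  rw [(hmg _).2 ⟨b, rfl⟩, map_zero', sub_zero] at h1
  exact h1

variable (p) in
theorem isHomologicalDimension_one : QuasiAb.IsHomologicalDimension (PAb p) 1 := by
  refine ⟨fun n hn A B => subsingleton_ext A B n hn, fun d hd => ?_⟩
  by_contra hd1
  obtain ⟨A, B, h⟩ := exists_not_subsingleton_ext p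
  exact h (hd 1 (not_le.1 hd1) A B)

end PAb

end ProP

theorem mainTheorem6 (p : ℕ) (hp : p.Prime) :
    -- `PAb(p)` is quasi-abelian and has enough injectives
    QuasiAb.IsQuasiAbelian (ProP.PAb p) ∧ QuasiAb.HasEnoughInjectives (ProP.PAb p) ∧
    -- `(ℤ(p^∞)^(ω))^ω`, with the product topology, is an injective object of `PAb(p)`, and each
    -- object admits an admissible monic into it that is a closed embedding
    (∃ I : ProP.PAb p, Nonempty (I ≃ₜ+ (ℕ → ProP.PruferSum p)) ∧ QuasiAb.IsInjective I ∧
      ∀ A : ProP.PAb p, ∃ m : A ⟶ I, IsClosedEmbedding m ∧ QuasiAb.AdmissibleMono m) ∧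
    -- quotients of injectives are injective
    (∀ A : ProP.PAb p, QuasiAb.IsInjective A →
      ∀ (B : Type) [AddCommGroup B] [TopologicalSpace B] [IsTopologicalAddGroup B] [PolishSpace B]
        (π : A →ₜ+ B), Function.Surjective π →
          ∃ hB : ProP.IsProP B p, QuasiAb.IsInjective (ProP.PAb.mk B hB)) ∧
    -- `PAb(p)` has homological dimension `1`
    QuasiAb.IsHomologicalDimension (ProP.PAb p) 1 := by
  have := Fact.mk hp
  refine ⟨ProP.PAb.isQuasiAbelian p, ProP.PAb.hasEnoughInjectives p,
    ⟨ProP.PAb.pruferPower p, ⟨ProP.PAb.pruferPowerEquiv p⟩, ProP.PAb.isInjective_pruferPower p,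
      fun A => ?_⟩, fun A hA B _ _ _ _ π hπ => ?_, ProP.PAb.isHomologicalDimension_one p⟩
  · obtain ⟨m, hm⟩ := ProP.PAb.exists_isClosedEmbedding_pruferPower A
    exact ⟨m, hm, ProP.PAb.admissibleMono_of_isClosedEmbedding hm⟩
  · have hB := ProP.PAb.isProP_of_surjective A B π hπ
    exact ⟨hB, ProP.PAb.isInjective_of_surjective (B := ProP.PAb.mk B hB) hA π hπ⟩
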